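/- **Setting.** Let $\mathcal S'$ and $\mathcal U$ be finite nonempty sets (states and controls), $p(j\mid i,u)$ a controlled transition probability function ($p(\cdot\mid i,u)$ is a probability distribution on $\mathcal S'$ for all $i,u$), $k:\mathcal S'\times\mathcal U\to\mathbb R$ a running cost and $i_0\in\mathcal S'$ a reference state. Assume that the chain is irreducible under all control choices, i.e. for every map $\varphi:\mathcal S'\to\mathcal U$ the transition matrix $(p(j\mid i,\varphi(i)))_{i,j}$ is irreducible. Let $\Phi_s(u\mid i)$ be a randomized sampling policy with $\Phi_s(u\mid i)>0$ for all $i,u$, and let $\pi$ be the stationary distribution of the chain $Z_n=(X_n,U_n)$ on $\mathcal S'\times\mathcal U$ with transition probabilities $\mathbb P(Z_{n+1}=(j,v)\mid Z_n=(i,u))=p(j\mid i,u)\Phi_s(v\mid j)$. For $Q\in\mathbb R^{\mathcal S'\times\mathcal U}$, $\rho\in\mathbb R$, $Z\in\mathcal S'\times\mathcal U$ and $\beta'>0$ put $$f^{i,u}(Q,\rho,Z)=I\{Z=(i,u)\}\Big(k(i,u)-Q(i,u)-\rho+\sum_{j\ne i_0}p(j\mid i,u)\min_vQ(j,v)\Big)+Q(i,u),$$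 $$\bar f(Q,\rho)=\sum_{(i,u)}\pi(i,u)\,f(Q,\rho,(i,u)),\qquad \bar g(Q,\rho)=\beta'\min_vQ(i_0,v)+\rho .$$ A controlled chain is a pair of processes $(X_n)$, $(U_n)$ in $\mathcal S'$, $\mathcal U$ with $\mathbb P(X_{n+1}=j\mid X_m,U_m,m\le n)=p(j\mid X_n,U_n)$ a.s.; its average cost is $\lim_{n\to\infty}\frac1n\sum_{m=0}^{n-1}\mathbb E[k(X_m,U_m)]$, when this limit exists. A stationary policy $\varphi:\mathcal S'\to\mathcal U$ (that is, $U_n=\varphi(X_n)$) is optimal if, from every initial state, its average cost exists and is the least average cost of all controlled chains started there. **Proposition.** (a) There are $\lambda\in(0,1)$ and weights $w_{i,u}>0$ such that, with $\|x\|_w=\max_{i,u}|w_{i,u}x_{i,u}|$, $\|\bar f(Q_1,\rho)-\bar f(Q_2,\rho)\|_w\le\lambda\|Q_1-Q_2\|_w$ for all $Q_1,Q_2$ and all $\rho\in\mathbb R$. For each $\rho$ the map $\bar f(\cdot,\rho)$ has a unique fixed point, denoted $Q^*(\rho)$. (b) The function $\rho\mapsto\min_vQ^*(\rho)(i_0,v)$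 is concave, piecewise linear with finitely many pieces, and strictly decreasing. For all sufficiently small $\beta'>0$ there is $\mu\in(0,1)$ with $|\bar g(Q^*(\rho_2),\rho_2)-\bar g(Q^*(\rho_1),\rho_1)|\le\mu|\rho_2-\rho_1|$ for all $\rho_1,\rho_2\in\mathbb R$. (c) For every $\beta'>0$ the map $\rho\mapsto\bar g(Q^*(\rho),\rho)$ has a unique fixed point $\rho^*$, the same for all $\beta'$. From every initial state, $\rho^*$ is the minimum of the average cost over all controlled chains started there; moreover $\rho^*\le\liminf_{n}\frac1n\sum_{m<n}\mathbb E[k(X_m,U_m)]$ for every controlled chain. The vector $Q^*=Q^*(\rho^*)$ is the vector of optimal Q-values with reference state $i_0$: it satisfies $\min_vQ^*(i_0,v)=0$ and $$Q^*(i,u)=k(i,u)-\rho^*+\sum_{j}p(j\mid i,u)\min_vQ^*(j,v)\quad\text{for all }i,u;$$ a stationary policy $\varphi$ is optimal if and only if $Q^*(i,\varphi(i))=\min_vQ^*(i,v)$ for all $i$; optimal stationary policies exist; and for every optimal stationary policy $\varphi$ and all $(i,u)$, $$Q^*(i,u)=\mathbb E\Big[\sum_{m=0}^{\tau-1}\big(k(X_m,U_m)-\rho^*\big)\Big],$$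 where $(X_0,U_0)=(i,u)$, $U_m=\varphi(X_m)$ for $m\ge1$, and $\tau=\min\{m\ge1:X_m=i_0\}$, which is a.s. finite, the sum being integrable. -/

import Mathlib

open MeasureTheory ProbabilityTheory Filter Topology

namespace SSPQ

noncomputable section

/-- `min_v Q(j,v)`. -/
def minQ {S U : Type*} [Fintype U] [Nonempty U] (Q : S × U → ℝ) (j : S) : ℝ :=
  Finset.univ.inf' Finset.univ_nonempty (fun v => Q (j, v))

/-- The weighted max-norm `‖x‖_w = max_z |w z * x z|`. -/
def wnorm {ι : Type*} (w x : ι → ℝ) : ℝ := ⨆ z, |w z * x z|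

section Maps

variable {S U : Type*} [Fintype S] [Fintype U] [DecidableEq S] [DecidableEq U] [Nonempty U]

/-- The map `f^{i,u}(Q, ρ, Z)` of SSP Q-learning, where `p i u` is the law `p(· | i, u)`. -/
def f (p : S → U → PMF S) (k : S × U → ℝ) (i₀ : S) (Q : S × U → ℝ) (ρ : ℝ) (Z : S × U) :
    S × U → ℝ := fun z =>
  (if Z = z then
    k z - Q z - ρ + ∑ j ∈ Finset.univ.filter (fun j => j ≠ i₀), (p z.1 z.2 j).toReal * minQ Q j
    else 0) + Q z

/-- The average of `f` over `Z` with law `π`. -/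
def fbar (p : S → U → PMF S) (k : S × U → ℝ) (i₀ : S) (π : PMF (S × U))
    (Q : S × U → ℝ) (ρ : ℝ) : S × U → ℝ := fun z =>
  ∑ Z : S × U, (π Z).toReal * f p k i₀ Q ρ Z z

/-- `gbar(Q, ρ) = β' min_v Q(i₀,v) + ρ`. -/
def gbar {S U : Type*} [Fintype U] [Nonempty U] (i₀ : S) (β' : ℝ) (Q : S × U → ℝ) (ρ : ℝ) : ℝ :=
  β' * minQ Q i₀ + ρ

end Maps

/-- One step of the chain `Z_n = (X_n, U_n)` under the sampling policy `Φ`: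
from `(x, u)` to `(j, v)` with probability `p(j | x, u) Φ(v | j)`. -/
def zStep {S U : Type*} (p : S → U → PMF S) (Φ : S → PMF U) (z : S × U) : PMF (S × U) :=
  (p z.1 z.2).bind fun j => (Φ j).map fun v => (j, v)

/-- `π` is a stationary distribution of `Z_n = (X_n, U_n)` under the sampling policy `Φ`. -/
def IsStationary {S U : Type*} (p : S → U → PMF S) (Φ : S → PMF U) (π : PMF (S × U)) : Prop :=
  π.bind (zStep p Φ) = π

/-- The chain is irreducible under all control choices: for every stationary deterministic choice
of controls `φ`, the transition matrix `p(j | i, φ(i))` is irreducible. (Irreducibility under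
randomized stationary controls follows, as their transition graphs are larger.) -/
def IrreducibleUnderAllControls {S U : Type*} (p : S → U → PMF S) : Prop :=
  ∀ φ : S → U, (Matrix.of fun i j => (p i (φ i) j).toReal).IsIrreducible

/-- A continuous function on `ℝ`, affine on every interval that avoids a finite set of
breakpoints. -/
def IsPiecewiseLinear (h : ℝ → ℝ) : Prop :=
  Continuous h ∧ ∃ B : Finset ℝ, ∀ I : Set ℝ, I.OrdConnected → Disjoint I (B : Set ℝ) →
    ∃ a b : ℝ, ∀ x ∈ I, h x = a * x + b

section Control

variable {S U : Type*} [MeasurableSpace S] [MeasurableSpace U]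

/-- The σ-algebra of the history `(X_m, U_m)`, `m ≤ n`. -/
abbrev history {Ω : Type*} (X : ℕ → Ω → S) (A : ℕ → Ω → U) (n : ℕ) : MeasurableSpace Ω :=
  MeasurableSpace.comap (fun ω (m : Fin (n + 1)) => (X m ω, A m ω)) inferInstance

/-- `(X_n)` is a controlled Markov chain with control process `(A_n)` and transition function `p`:
`P(X_{n+1} = j | X_m, A_m, m ≤ n) = p(j | X_n, A_n)` a.s.  The control is otherwise arbitrary;
it may be randomized and depend on the whole past. -/
structure IsControlledChain (p : S → U → PMF S) {Ω : Type*} [MeasurableSpace Ω] (P : Measure Ω)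
    (X : ℕ → Ω → S) (A : ℕ → Ω → U) : Prop where
  measurable_state : ∀ n, Measurable (X n)
  measurable_control : ∀ n, Measurable (A n)
  markov : ∀ n j, P[Set.indicator (X (n + 1) ⁻¹' {j}) (fun _ => (1 : ℝ)) | history X A n]
    =ᵐ[P] fun ω => (p (X n ω) (A n ω) j).toReal

/-- `(1/n) ∑_{m<n} E[k(X_m, A_m)]`. -/
def averageCost {S U : Type*} (k : S × U → ℝ) {Ω : Type*} [MeasurableSpace Ω] (P : Measure Ω)
    (X : ℕ → Ω → S) (A : ℕ → Ω → U) (n : ℕ) : ℝ :=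
  (1 / (n : ℝ)) * ∑ m ∈ Finset.range n, ∫ ω, k (X m ω, A m ω) ∂P

/-- State coordinates on the path space `(S × U)^ℕ`. -/
def pathState {S U : Type*} (n : ℕ) (ω : ℕ → S × U) : S := (ω n).1

/-- Control coordinates on the path space `(S × U)^ℕ`. -/
def pathControl {S U : Type*} (n : ℕ) (ω : ℕ → S × U) : U := (ω n).2

/-- All average costs `lim (1/n) ∑_{m<n} E[k(X_m, U_m)]` of controlled chains started at `i`
for which the limit exists; a controlled chain is given by its law on the path space. -/
def averageCosts (p : S → U → PMF S) (k : S × U → ℝ) (i : S) : Set ℝ :=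
  {c | ∃ P : Measure (ℕ → S × U), IsProbabilityMeasure P ∧
    IsControlledChain p P pathState pathControl ∧ (∀ᵐ ω ∂P, pathState 0 ω = i) ∧
    Tendsto (averageCost k P pathState pathControl) atTop (𝓝 c)}

variable [Finite S] [Finite U] [MeasurableSingletonClass S] [MeasurableSingletonClass U]

/-- Transition kernels of `(X_n, U_n)` under the stationary policy `φ`: from `(x, u)` the next
state is drawn from `p(· | x, u)`, and the next control is `φ` of the next state. -/
def policyKernel (p : S → U → PMF S) (φ : S → U) (n : ℕ) :
    Kernel ((i : Finset.Iic n) → S × U) (S × U) :=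
  Kernel.ofFunOfCountable fun h =>
    ((p (h ⟨n, by simp⟩).1 (h ⟨n, by simp⟩).2).map fun j => (j, φ j)).toMeasure

instance (p : S → U → PMF S) (φ : S → U) (n : ℕ) : IsMarkovKernel (policyKernel p φ n) :=
  ⟨fun _ => PMF.toMeasure.isProbabilityMeasure _⟩

/-- The law on the path space of the chain started with state and control `z = (i, u)` at time `0`
and following the stationary policy `φ` from time `1` on. -/
def policyLaw (p : S → U → PMF S) (φ : S → U) (z : S × U) : Measure (ℕ → S × U) :=
  Kernel.traj (X := fun _ => S × U) (policyKernel p φ) 0 (fun _ => z)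

/-- The stationary policy `φ` is optimal: from every initial state its average cost exists and is
the least average cost of all controlled chains started there. -/
def IsOptimalPolicy (p : S → U → PMF S) (k : S × U → ℝ) (φ : S → U) : Prop :=
  ∀ i, ∃ c, Tendsto (averageCost k (policyLaw p φ (i, φ i)) pathState pathControl) atTop (𝓝 c) ∧
    IsLeast (averageCosts p k i) c

/-- The first time `m ≥ 1` at which the path is in `i₀` (with value `0` on paths without
such a time). -/
def returnTime {S U : Type*} (i₀ : S) (ω : ℕ → S × U) : ℕ :=
  sInf {m | 1 ≤ m ∧ pathState m ω = i₀}

/-- `q` is the average-cost (relative) Q-value of the policy `φ` at `z`, for the average cost `c`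
and the reference state `i₀`: with `τ` the first time `m ≥ 1` at which `X_m = i₀`, `τ` is a.s.
finite and `q = E[∑_{m<τ} (k(X_m, U_m) - c)]`, where the chain starts from `(X_0, U_0) = z` and
follows `φ` from time `1` on. -/
def IsRelativeQValue (p : S → U → PMF S) (k : S × U → ℝ) (i₀ : S) (φ : S → U) (c : ℝ)
    (z : S × U) (q : ℝ) : Prop :=
  (∀ᵐ ω ∂policyLaw p φ z, ∃ m, 1 ≤ m ∧ pathState m ω = i₀) ∧
  Integrable (fun ω => ∑ m ∈ Finset.range (returnTime i₀ ω), (k (ω m) - c)) (policyLaw p φ z) ∧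
  ∫ ω, ∑ m ∈ Finset.range (returnTime i₀ ω), (k (ω m) - c) ∂policyLaw p φ z = q

end Control

end

end SSPQ

namespace SSPQ

/-! ### The chain killed on entering the reference state: maximum principle and optimality equation.
-/

section

/-! Everything reduces to the chain killed on entering `i₀`. Irreducibility under every policy gives
a maximum principle (`nonpos_of_le_killed`): a subharmonic function of the killed chain is
nonpositive. It yields unique policy evaluation, an optimality equation (`exists_optimal_value`)
and, for running cost `-1`, a Lyapunov function `V`, the maximal expected killing time. Weights `1 /
V` make `fbar` a contraction; its fixed points are the solutions of the killed optimality equation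
with cost `k - ρ`, so existence and uniqueness come from that equation.

For a policy `φ`, the cost of a cycle from `i₀` to `i₀` is affine in `ρ` with slope `-γ φ`, where `γ
φ ≥ 1` is the mean cycle length. Hence `minQ (Qs ρ) i₀` is a minimum of finitely many such lines,
and all of (b) follows from facts on lower envelopes. At its unique zero `ρs`, killed and full
expectations agree (`killed_eq_sum`), so the killed equation becomes the average-cost optimality
equation.

Summing that equation along any controlled chain telescopes (`IsControlledChain.sum_integral_cost`),
which bounds average costs below by `ρs`, with equality for greedy policies. Conversely, for an
optimal policy the optimal potential minus the policy's own Poisson potential is subharmonic, hence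
constant, so the policy is greedy. The return-time formula is the killed equation summed up to the
return to `i₀`, whose tail is geometric thanks to `V`. -/

theorem sum_toReal_eq_one {α : Type*} [Fintype α] (q : PMF α) : ∑ j, (q j).toReal = 1 := by
  have h := q.tsum_coe
  rw [tsum_fintype] at h
  rw [← ENNReal.toReal_sum fun j _ => q.apply_ne_top j, h, ENNReal.toReal_one]

theorem minQ_le {S U : Type*} [Fintype U] [Nonempty U] (Q : S × U → ℝ) (i : S) (u : U) :
    minQ Q i ≤ Q (i, u) :=
  Finset.inf'_le _ (Finset.mem_univ u)

theorem exists_eq_minQ {S U : Type*} [Fintype U] [Nonempty U] (Q : S × U → ℝ) (i : S) :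
    ∃ u, Q (i, u) = minQ Q i := by
  obtain ⟨u, -, hu⟩ := Finset.exists_mem_eq_inf' Finset.univ_nonempty (fun v => Q (i, v))
  exact ⟨u, hu.symm⟩

theorem le_minQ {S U : Type*} [Fintype U] [Nonempty U] {Q : S × U → ℝ} {i : S} {c : ℝ}
    (h : ∀ u, c ≤ Q (i, u)) : c ≤ minQ Q i :=
  Finset.le_inf' _ _ fun u _ => h u

theorem minQ_le_minQ_add {S U : Type*} [Fintype U] [Nonempty U] {Q₁ Q₂ : S × U → ℝ} {i : S} {c : ℝ}
    (h : ∀ u, Q₁ (i, u) ≤ Q₂ (i, u) + c) : minQ Q₁ i ≤ minQ Q₂ i + c := by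
  obtain ⟨u, hu⟩ := exists_eq_minQ Q₂ i
  rw [← hu]
  exact (minQ_le Q₁ i u).trans (h u)

theorem abs_minQ_sub_le {S U : Type*} [Fintype U] [Nonempty U] {Q₁ Q₂ : S × U → ℝ} {i : S} {c : ℝ}
    (h : ∀ u, |Q₁ (i, u) - Q₂ (i, u)| ≤ c) : |minQ Q₁ i - minQ Q₂ i| ≤ c := by
  have h1 := minQ_le_minQ_add (Q₁ := Q₁) (Q₂ := Q₂) (i := i) (c := c)
    fun u => by linarith [(abs_le.1 (h u)).2]
  have h2 := minQ_le_minQ_add (Q₁ := Q₂) (Q₂ := Q₁) (i := i) (c := c)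
    fun u => by linarith [(abs_le.1 (h u)).1]
  rw [abs_le]
  constructor <;> linarith

theorem exists_toReal_pos {α : Type*} (q : PMF α) : ∃ j, 0 < (q j).toReal := by
  obtain ⟨j, hj⟩ := q.support_nonempty
  exact ⟨j, ENNReal.toReal_pos ((q.mem_support_iff j).1 hj) (q.apply_ne_top j)⟩

/-- At a point where an average attains an upper bound, the bound is attained on the support. -/
theorem eq_of_le_sum_toReal_mul {α : Type*} [Fintype α] (q : PMF α) {g : α → ℝ} {M : ℝ} (hg : ∀ j, g j ≤ M)
    (h : M ≤ ∑ j, (q j).toReal * g j) {j : α} (hj : 0 < (q j).toReal) : g j = M := by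
  have h1 : ∑ j, (q j).toReal * (M - g j) ≤ 0 := by
    simp only [mul_sub, Finset.sum_sub_distrib, ← Finset.sum_mul, sum_toReal_eq_one]
    linarith
  have h2 : ∀ j ∈ Finset.univ, 0 ≤ (q j).toReal * (M - g j) := fun j _ =>
    mul_nonneg ENNReal.toReal_nonneg (sub_nonneg.2 (hg j))
  have h3 := (Finset.sum_eq_zero_iff_of_nonneg h2).1 (le_antisymm h1 (Finset.sum_nonneg h2)) j
    (Finset.mem_univ j)
  rcases mul_eq_zero.1 h3 with h4 | h4
  · exact absurd h4 hj.ne'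
  · linarith

/-- A nonempty set of states which is closed under the transitions of `φ` is everything. -/
theorem mem_of_closed {S U : Type*} {p : S → U → PMF S} (hirr : IrreducibleUnderAllControls p) (φ : S → U)
    {R : Set S} (hR : ∀ i ∈ R, ∀ j, 0 < (p i (φ i) j).toReal → j ∈ R) {i : S} (hi : i ∈ R)
    (j : S) : j ∈ R := by
  let A : Matrix S S ℝ := Matrix.of fun i j => (p i (φ i) j).toReal
  let : Quiver S := Matrix.toQuiver A
  obtain ⟨q, -⟩ := (hirr φ).connected i j
  induction q with
  | nil => exact hi
  | cons _ e ih => exact hR _ ih _ e.down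

/-- A function that is subharmonic for a stationary policy is constant. -/
theorem eq_of_le_sum {S U : Type*} [Fintype S] {p : S → U → PMF S} (hirr : IrreducibleUnderAllControls p) (φ : S → U) {d : S → ℝ}
    (hd : ∀ i, d i ≤ ∑ j, (p i (φ i) j).toReal * d j) (i i' : S) : d i = d i' := by
  have : Nonempty S := ⟨i⟩
  obtain ⟨m, hm⟩ := Finite.exists_max d
  -- An average attains the maximum only if all successors do, so the set of maximisers is closed.
  have key : ∀ j, j ∈ {j | d j = d m} := mem_of_closed hirr φ (R := {j | d j = d m})
    (fun i hi j hj => eq_of_le_sum_toReal_mul (p i (φ i)) hm (hi ▸ hd i) hj) rfl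
  exact (key i).trans (key i').symm

variable {S U : Type*} [Fintype S] [DecidableEq S]

/-- The expectation `∑_{j ≠ i₀} p(j | i, u) h(j)` for the chain killed on entering `i₀`. -/
noncomputable def killed (p : S → U → PMF S) (i₀ : S) (i : S) (u : U) (h : S → ℝ) : ℝ :=
  ∑ j ∈ Finset.univ.filter (fun j => j ≠ i₀), (p i u j).toReal * h j

section Killed

variable (p : S → U → PMF S) (i₀ : S)

theorem killed_eq_sum_ite (i : S) (u : U) (h : S → ℝ) :
    killed p i₀ i u h = ∑ j, (p i u j).toReal * (if j ≠ i₀ then h j else 0) := by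
  simp [killed, Finset.sum_filter]

theorem killed_mono (i : S) (u : U) {h g : S → ℝ} (hg : ∀ j, h j ≤ g j) :
    killed p i₀ i u h ≤ killed p i₀ i u g :=
  Finset.sum_le_sum fun j _ => mul_le_mul_of_nonneg_left (hg j) ENNReal.toReal_nonneg

theorem killed_add (i : S) (u : U) (h g : S → ℝ) :
    killed p i₀ i u (h + g) = killed p i₀ i u h + killed p i₀ i u g := by
  simp [killed, mul_add, Finset.sum_add_distrib]

theorem killed_sub (i : S) (u : U) (h g : S → ℝ) :
    killed p i₀ i u (h - g) = killed p i₀ i u h - killed p i₀ i u g := by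
  simp [killed, mul_sub, Finset.sum_sub_distrib]

theorem killed_smul (i : S) (u : U) (c : ℝ) (h : S → ℝ) :
    killed p i₀ i u (c • h) = c * killed p i₀ i u h := by
  simp [killed, Finset.mul_sum, mul_left_comm]

theorem killed_nonpos (i : S) (u : U) {h : S → ℝ} (hh : ∀ j, h j ≤ 0) :
    killed p i₀ i u h ≤ 0 :=
  Finset.sum_nonpos fun j _ => mul_nonpos_of_nonneg_of_nonpos ENNReal.toReal_nonneg (hh j)

/-- The bridge from the killed equation to the average-cost equation. -/
theorem killed_eq_sum (i : S) (u : U) {h : S → ℝ} (h0 : h i₀ = 0) :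
    killed p i₀ i u h = ∑ j, (p i u j).toReal * h j := by
  rw [killed_eq_sum_ite]
  refine Finset.sum_congr rfl fun j _ => ?_
  split_ifs with hj
  · rfl
  · rw [not_not.1 hj, h0]

end Killed

variable {p : S → U → PMF S}

/-- Maximum principle for the chain killed on entering `i₀`. -/
theorem nonpos_of_le_killed (hirr : IrreducibleUnderAllControls p) (i₀ : S) (φ : S → U)
    {d : S → ℝ} (hd : ∀ i, d i ≤ killed p i₀ i (φ i) d) (i : S) : d i ≤ 0 := by
  have : Nonempty S := ⟨i⟩
  obtain ⟨m, hm⟩ := Finite.exists_max d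
  by_contra! hi
  have hM : 0 < d m := hi.trans_le (hm i)
  -- The killed average contributes `0 < d m` at `i₀`, so a successor of a maximiser is a maximiser
  -- other than `i₀`.
  have step : ∀ i, d i = d m → ∀ j, 0 < (p i (φ i) j).toReal → j ≠ i₀ ∧ d j = d m := by
    intro i him j hj
    have h1 := hd i
    rw [killed_eq_sum_ite, him] at h1
    have h2 := eq_of_le_sum_toReal_mul (p i (φ i)) (fun j => ?_) h1 hj
    · split_ifs at h2 with h3
      · exact ⟨h3, h2⟩
      · exact absurd h2 hM.ne
    · split_ifs
      · exact hm j
      · exact hM.le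
  -- The maximiser `m` may be `i₀` itself; one transition leads into a closed set that avoids `i₀`,
  -- which irreducibility forbids.
  obtain ⟨j, hj⟩ := exists_toReal_pos (p m (φ m))
  have h := mem_of_closed hirr φ (R := {j | j ≠ i₀ ∧ d j = d m})
    (fun i hi j hj => step i hi.2 j hj) (step m rfl j hj) i₀
  exact h.1 rfl

/-- Policy evaluation: `h = r + P h` has a solution for the chain killed on entering `i₀`. -/
theorem exists_policy_value (hirr : IrreducibleUnderAllControls p) (i₀ : S) (φ : S → U)
    (r : S → ℝ) : ∃ h : S → ℝ, ∀ i, h i = r i + killed p i₀ i (φ i) h := by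
  let T : (S → ℝ) →ₗ[ℝ] (S → ℝ) :=
    { toFun := fun h i => h i - killed p i₀ i (φ i) h
      map_add' := fun h g => by ext i; simp only [killed_add, Pi.add_apply]; ring
      map_smul' := fun c h => by
        ext i; simp only [killed_smul, Pi.smul_apply, smul_eq_mul, RingHom.id_apply]; ring }
  -- The maximum principle in both directions; in finite dimension injectivity gives surjectivity.
  have hT : Function.Injective T := by
    intro h g hg
    have h1 : ∀ i, h i - killed p i₀ i (φ i) h = g i - killed p i₀ i (φ i) g := congrFun hg
    ext i
    have h2 := nonpos_of_le_killed hirr i₀ φ (d := h - g)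
      (fun i => by rw [killed_sub, Pi.sub_apply]; linarith [h1 i]) i
    have h3 := nonpos_of_le_killed hirr i₀ φ (d := g - h)
      (fun i => by rw [killed_sub, Pi.sub_apply]; linarith [h1 i]) i
    rw [Pi.sub_apply] at h2 h3
    linarith
  obtain ⟨h, hh⟩ := LinearMap.surjective_of_injective hT r
  refine ⟨h, fun i => ?_⟩
  have h1 : h i - killed p i₀ i (φ i) h = r i := congrFun hh i
  linarith

/-- The optimality equation for the chain killed on entering `i₀`, with an optimal policy. -/
theorem exists_optimal_value [Finite U] [Nonempty U] (hirr : IrreducibleUnderAllControls p)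
    (i₀ : S) (r : S → U → ℝ) : ∃ h : S → ℝ, ∃ φ : S → U,
      (∀ i, h i = r i (φ i) + killed p i₀ i (φ i) h) ∧
      ∀ i u, h i ≤ r i u + killed p i₀ i u h := by
  choose H hH using fun φ : S → U => exists_policy_value hirr i₀ φ (fun i => r i (φ i))
  -- Policy improvement: a control violating the inequality at one state would give a policy of
  -- strictly smaller total value.
  obtain ⟨φ, hφ⟩ := Finite.exists_min fun φ => ∑ i, H φ i
  refine ⟨H φ, φ, hH φ, fun i u => ?_⟩
  by_contra! hlt
  let ψ := Function.update φ i u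
  have hstep : ∀ j, r j (ψ j) + killed p i₀ j (ψ j) (H φ) ≤ H φ j := by
    intro j
    by_cases hj : j = i
    · subst hj
      simpa [ψ] using hlt.le
    · simpa [ψ, hj] using (hH φ j).ge
  have hd := nonpos_of_le_killed hirr i₀ ψ (d := H ψ - H φ) fun j => by
    rw [killed_sub, Pi.sub_apply]
    linarith [hH ψ j, hstep j]
  simp only [Pi.sub_apply, sub_nonpos] at hd
  have hi : H ψ i < H φ i := by
    have h1 := hH ψ i
    have h2 := killed_mono p i₀ i (ψ i) hd
    have h3 : ψ i = u := by simp [ψ]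
    rw [h3] at h1 h2
    linarith
  exact absurd (hφ ψ) (not_le.2 (Finset.sum_lt_sum (fun j _ => hd j) ⟨i, Finset.mem_univ i, hi⟩))

/-- A Lyapunov function for the chain killed on entering `i₀`, uniformly in the control. -/
theorem exists_lyapunov [Finite U] [Nonempty U] (hirr : IrreducibleUnderAllControls p) (i₀ : S) :
    ∃ V : S → ℝ, (∀ i, 1 ≤ V i) ∧ ∃ β ∈ Set.Ioo (0 : ℝ) 1, ∀ i u,
      killed p i₀ i u V ≤ β * V i := by
  obtain ⟨h, φ, h1, h2⟩ := exists_optimal_value hirr i₀ (fun _ _ => -1)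
  have h3 := nonpos_of_le_killed hirr i₀ φ (d := h) fun i => by linarith [h1 i]
  have h4 : ∀ i, h i ≤ -1 := fun i => by linarith [h1 i, killed_nonpos p i₀ i (φ i) h3]
  have : Nonempty S := ⟨i₀⟩
  obtain ⟨m, hm⟩ := Finite.exists_min h
  have hM : 0 < 1 - h m := by linarith [h4 m]
  -- With `V = -h` the optimality inequality says that the killed mean of `V` is at most `V - 1`,
  -- and `V ≤ 1 - h m` turns the loss of `1` into a factor. The extra `1` in the denominator keeps
  -- the factor positive when `V` is identically `1`.
  refine ⟨-h, fun i => ?_, 1 - 1 / (1 - h m), ⟨?_, ?_⟩, fun i u => ?_⟩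
  · simpa using le_neg.2 (h4 i)
  · rw [sub_pos, div_lt_one hM]
    linarith [h4 m]
  · linarith [one_div_pos.2 hM]
  · have h5 : killed p i₀ i u (-h) = - killed p i₀ i u h := by simp [killed]
    have h6 : 1 / (1 - h m) * (-h i) ≤ 1 := by
      rw [one_div_mul_eq_div, div_le_one hM]
      linarith [hm i]
    rw [h5, Pi.neg_apply, sub_mul]
    linarith [h2 i u]

end

section

/-! ### Lower envelopes of affine functions. -/

section LowerEnvelope

variable {ι : Type*} {α γ : ι → ℝ} {G : ℝ → ℝ}

/-- A lower envelope of affine functions is concave. -/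
theorem concaveOn_of_lower_envelope (hle : ∀ ρ φ, G ρ ≤ α φ - ρ * γ φ)
    (heq : ∀ ρ, ∃ φ, G ρ = α φ - ρ * γ φ) : ConcaveOn ℝ Set.univ G := by
  refine ⟨convex_univ, fun x _ y _ a b ha hb hab => ?_⟩
  obtain ⟨φ, hφ⟩ := heq (a • x + b • y)
  rw [hφ]
  simp only [smul_eq_mul]
  have h1 := mul_le_mul_of_nonneg_left (hle x φ) ha
  have h2 := mul_le_mul_of_nonneg_left (hle y φ) hb
  have h3 : α φ - (a * x + b * y) * γ φ = a * (α φ - x * γ φ) + b * (α φ - y * γ φ) := by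
    linear_combination (- α φ) * hab
  linarith

/-- The decrease of a lower envelope of affine functions is controlled by the slopes. -/
theorem lower_envelope_sub_le (hle : ∀ ρ φ, G ρ ≤ α φ - ρ * γ φ)
    (heq : ∀ ρ, ∃ φ, G ρ = α φ - ρ * γ φ) {L : ℝ} (hL : ∀ φ, γ φ ≤ L) {x y : ℝ} (hxy : x ≤ y) :
    G x - G y ≤ L * (y - x) := by
  obtain ⟨φ, hφ⟩ := heq y
  have h1 := hle x φ
  have h2 := mul_le_mul_of_nonneg_right (hL φ) (sub_nonneg.2 hxy)
  nlinarith

/-- The line active at `x` lies above `G` at `y` and has slope at most `-1`. -/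
theorem le_lower_envelope_sub (hle : ∀ ρ φ, G ρ ≤ α φ - ρ * γ φ)
    (heq : ∀ ρ, ∃ φ, G ρ = α φ - ρ * γ φ) (hγ : ∀ φ, 1 ≤ γ φ) {x y : ℝ} (hxy : x ≤ y) :
    y - x ≤ G x - G y := by
  obtain ⟨φ, hφ⟩ := heq x
  have h1 := hle y φ
  have h2 := mul_le_mul_of_nonneg_right (hγ φ) (sub_nonneg.2 hxy)
  nlinarith

theorem strictAnti_of_lower_envelope (hle : ∀ ρ φ, G ρ ≤ α φ - ρ * γ φ)
    (heq : ∀ ρ, ∃ φ, G ρ = α φ - ρ * γ φ) (hγ : ∀ φ, 1 ≤ γ φ) : StrictAnti G := fun x y hxy => by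
  linarith [le_lower_envelope_sub hle heq hγ hxy.le]

/-- On an interval that does not contain the point where two affine functions with different slopes
cross, the two functions do not change their order. -/
theorem affine_le_of_le {a c a' c' : ℝ} {I : Set ℝ} (hI : I.OrdConnected)
    (hcross : c ≠ c' → (a - a') / (c - c') ∉ I) {x₀ : ℝ} (hx₀ : x₀ ∈ I)
    (h₀ : a - x₀ * c ≤ a' - x₀ * c') {x : ℝ} (hx : x ∈ I) : a - x * c ≤ a' - x * c' := by
  by_cases hc : c = c'
  · subst hc
    linarith
  have hcc : c - c' ≠ 0 := sub_ne_zero.2 hc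
  by_contra! hlt
  set t := (a - a') / (c - c') with ht
  have hta : a - a' = t * (c - c') := by rw [ht, div_mul_cancel₀ _ hcc]
  refine hcross hc ?_
  rcases lt_or_gt_of_ne hcc with h | h
  · have h1 : t ≤ x := by nlinarith
    have h2 : x₀ ≤ t := by nlinarith
    exact hI.out hx₀ hx ⟨h2, h1⟩
  · have h1 : x ≤ t := by nlinarith
    have h2 : t ≤ x₀ := by nlinarith
    exact hI.out hx hx₀ ⟨h1, h2⟩

theorem continuous_of_lower_envelope [Finite ι] (hle : ∀ ρ φ, G ρ ≤ α φ - ρ * γ φ)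
    (heq : ∀ ρ, ∃ φ, G ρ = α φ - ρ * γ φ) : Continuous G := by
  have := Fintype.ofFinite ι
  have : Nonempty ι := ⟨(heq 0).choose⟩
  have hG : G = fun ρ => Finset.univ.inf' Finset.univ_nonempty fun φ => α φ - ρ * γ φ := by
    funext ρ
    refine le_antisymm (Finset.le_inf' _ _ fun φ _ => hle ρ φ) ?_
    obtain ⟨φ, hφ⟩ := heq ρ
    rw [hφ]
    exact Finset.inf'_le (fun φ => α φ - ρ * γ φ) (Finset.mem_univ φ)
  rw [hG]
  exact Continuous.finset_inf'_apply _ fun φ _ => by fun_prop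

/-- On an interval without crossing points of two lines, the line active at one point stays active
throughout. -/
theorem isPiecewiseLinear_of_lower_envelope [Finite ι] (hle : ∀ ρ φ, G ρ ≤ α φ - ρ * γ φ)
    (heq : ∀ ρ, ∃ φ, G ρ = α φ - ρ * γ φ) : IsPiecewiseLinear G := by
  have := Fintype.ofFinite ι
  refine ⟨continuous_of_lower_envelope hle heq,
    -- Pairs of equal slope contribute the value `0` of division by zero, a harmless extra
    -- breakpoint.
    Finset.univ.image fun q : ι × ι => (α q.1 - α q.2) / (γ q.1 - γ q.2), fun I hI hB => ?_⟩
  rcases I.eq_empty_or_nonempty with rfl | ⟨x₀, hx₀⟩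
  · exact ⟨0, 0, fun x hx => hx.elim⟩
  obtain ⟨φ, hφ⟩ := heq x₀
  refine ⟨-γ φ, α φ, fun x hx => ?_⟩
  obtain ⟨ψ, hψ⟩ := heq x
  have hcross : (α φ - α ψ) / (γ φ - γ ψ) ∉ I := fun hmem =>
    Set.disjoint_left.1 hB hmem (by
      rw [Finset.coe_image]
      exact ⟨(φ, ψ), by simp, rfl⟩)
  have h1 := affine_le_of_le hI (fun _ => hcross) hx₀ (hφ ▸ hle x₀ ψ) hx
  linarith [hle x φ]

/-- The zero is the least ratio `α φ / γ φ`; in the application, cost per cycle over cycle length.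
-/
theorem exists_zero_of_lower_envelope [Finite ι] (hle : ∀ ρ φ, G ρ ≤ α φ - ρ * γ φ)
    (heq : ∀ ρ, ∃ φ, G ρ = α φ - ρ * γ φ) (hγ : ∀ φ, 1 ≤ γ φ) : ∃ ρ, G ρ = 0 := by
  have : Nonempty ι := ⟨(heq 0).choose⟩
  obtain ⟨φ, hφ⟩ := Finite.exists_min fun φ => α φ / γ φ
  have hpos : ∀ φ, 0 < γ φ := fun φ => zero_lt_one.trans_le (hγ φ)
  refine ⟨α φ / γ φ, le_antisymm ?_ ?_⟩
  · have h := hle (α φ / γ φ) φ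
    rwa [div_mul_cancel₀ _ (hpos φ).ne', sub_self] at h
  · obtain ⟨ψ, hψ⟩ := heq (α φ / γ φ)
    have h := (le_div_iff₀ (hpos ψ)).1 (hφ ψ)
    linarith

/-- The relaxation `ρ ↦ β' G(ρ) + ρ` is a contraction for small `β'`. -/
theorem exists_contraction_of_lower_envelope [Finite ι] (hle : ∀ ρ φ, G ρ ≤ α φ - ρ * γ φ)
    (heq : ∀ ρ, ∃ φ, G ρ = α φ - ρ * γ φ) (hγ : ∀ φ, 1 ≤ γ φ) :
    ∃ βmax > (0 : ℝ), ∀ β' : ℝ, 0 < β' → β' < βmax → ∃ μ ∈ Set.Ioo (0 : ℝ) 1, ∀ x y : ℝ,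
      |(β' * G y + y) - (β' * G x + x)| ≤ μ * |y - x| := by
  have : Nonempty ι := ⟨(heq 0).choose⟩
  obtain ⟨φ, hφ⟩ := Finite.exists_max γ
  have hpos : 0 < γ φ := zero_lt_one.trans_le (hγ φ)
  -- Below this bound all slopes `1 - β' * γ` lie between `0` and `1 - β'`.
  refine ⟨1 / γ φ, one_div_pos.2 hpos, fun β' h0 h1 => ?_⟩
  have h2 : β' * γ φ < 1 := (lt_div_iff₀ hpos).1 h1
  have h3 : β' ≤ β' * γ φ := le_mul_of_one_le_right h0.le (hγ φ)
  have key : ∀ x y : ℝ, x ≤ y →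
      |(β' * G y + y) - (β' * G x + x)| ≤ (1 - β') * |y - x| := by
    intro x y hxy
    have h4 := mul_le_mul_of_nonneg_left (lower_envelope_sub_le hle heq hφ hxy) h0.le
    have h5 := mul_le_mul_of_nonneg_left (le_lower_envelope_sub hle heq hγ hxy) h0.le
    have h6 := mul_le_mul_of_nonneg_right h2.le (sub_nonneg.2 hxy)
    have h7 := mul_le_mul_of_nonneg_right h3 (sub_nonneg.2 hxy)
    rw [abs_of_nonneg (sub_nonneg.2 hxy), abs_le]
    constructor <;> nlinarith
  refine ⟨1 - β', ⟨by linarith, by linarith⟩, fun x y => ?_⟩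
  rcases le_total x y with h | h
  · exact key x y h
  · rw [abs_sub_comm, abs_sub_comm y]
    exact key y x h

end LowerEnvelope

/-! ### The averaged map `fbar`: positivity of `π` and contraction. -/

/-- A stationary law of the state-control chain charges every state-control pair. -/
theorem IsStationary.ne_zero {S U : Type*} {p : S → U → PMF S} {Φ : S → PMF U} {π : PMF (S × U)}
    (hπ : IsStationary p Φ π) (hirr : IrreducibleUnderAllControls p) (hΦ : ∀ i u, 0 < Φ i u)
    (z : S × U) : π z ≠ 0 := by
  have step : ∀ i u, π (i, u) ≠ 0 → ∀ j, 0 < (p i u j).toReal → ∀ v, π (j, v) ≠ 0 := by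
    intro i u hi j hj v
    rw [← PMF.mem_support_iff, ← show π.bind (zStep p Φ) = π from hπ, PMF.mem_support_bind_iff]
    refine ⟨(i, u), (PMF.mem_support_iff _ _).2 hi, ?_⟩
    rw [zStep, PMF.mem_support_bind_iff]
    refine ⟨j, (PMF.mem_support_iff _ _).2 fun h => by simp [h] at hj, ?_⟩
    rw [PMF.mem_support_map_iff]
    exact ⟨v, (PMF.mem_support_iff _ _).2 (hΦ j v).ne', rfl⟩
  obtain ⟨⟨i, u⟩, hi⟩ := π.support_nonempty
  obtain ⟨j, hj⟩ := exists_toReal_pos (p i u)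
  -- States charged together with all controls form a set closed under every policy, so a constant
  -- one suffices.
  exact mem_of_closed hirr (fun _ => u) (R := {j | ∀ v, π (j, v) ≠ 0})
    (fun i hi j hj => step i u (hi u) j hj) (step i u ((PMF.mem_support_iff _ _).1 hi) j hj) z.1 z.2

variable {S U : Type*} [Fintype S] [DecidableEq S] [Fintype U] [DecidableEq U] [Nonempty U]

theorem fbar_apply (p : S → U → PMF S) (k : S × U → ℝ) (i₀ : S) (π : PMF (S × U))
    (Q : S × U → ℝ) (ρ : ℝ) (z : S × U) :
    fbar p k i₀ π Q ρ z =
      (π z).toReal * (k z - Q z - ρ + killed p i₀ z.1 z.2 (minQ Q)) + Q z := by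
  simp only [fbar, f, mul_add, Finset.sum_add_distrib, ← Finset.sum_mul, sum_toReal_eq_one,
    one_mul, mul_ite, mul_zero, Finset.sum_ite_eq', Finset.mem_univ, if_true]
  simp only [killed]

theorem fbar_eq_self_iff {p : S → U → PMF S} {k : S × U → ℝ} {i₀ : S} {π : PMF (S × U)}
    (hπ : ∀ z, π z ≠ 0) {Q : S × U → ℝ} {ρ : ℝ} :
    fbar p k i₀ π Q ρ = Q ↔ ∀ i u, Q (i, u) = k (i, u) - ρ + killed p i₀ i u (minQ Q) := by
  rw [funext_iff, Prod.forall]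
  refine forall₂_congr fun i u => ?_
  have h : (π (i, u)).toReal ≠ 0 := (ENNReal.toReal_pos (hπ _) (π.apply_ne_top _)).ne'
  rw [fbar_apply, add_eq_right, mul_eq_zero, or_iff_right h]
  constructor <;> intro h <;> linarith

/-- The averaged SSP Q-learning map is a contraction in a weighted max-norm. -/
theorem exists_fbar_contraction {p : S → U → PMF S} (hirr : IrreducibleUnderAllControls p)
    (k : S × U → ℝ) (i₀ : S) {π : PMF (S × U)} (hπ : ∀ z, π z ≠ 0) :
    ∃ lam ∈ Set.Ioo (0 : ℝ) 1, ∃ w : S × U → ℝ, (∀ z, 0 < w z) ∧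
      ∀ (ρ : ℝ) (Q₁ Q₂ : S × U → ℝ),
        wnorm w (fbar p k i₀ π Q₁ ρ - fbar p k i₀ π Q₂ ρ) ≤ lam * wnorm w (Q₁ - Q₂) := by
  obtain ⟨V, hV, β, ⟨hβ0, hβ1⟩, hVβ⟩ := exists_lyapunov hirr i₀
  have : Nonempty S := ⟨i₀⟩
  have hV0 : ∀ i, 0 < V i := fun i => zero_lt_one.trans_le (hV i)
  obtain ⟨m, hm⟩ := Finite.exists_min fun z => (π z).toReal
  have hm0 : 0 < (π m).toReal := ENNReal.toReal_pos (hπ m) (π.apply_ne_top m)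
  have hp1 : ∀ z, (π z).toReal ≤ 1 := fun z =>
    ENNReal.toReal_le_of_le_ofReal zero_le_one (by simpa using π.coe_le_one z)
  -- Coordinate `z` mixes the identity (factor `1`) and the killed optimality operator (factor `β`)
  -- with weight `π z` on the latter; the least weight is the worst case.
  refine ⟨1 - (π m).toReal * (1 - β), ⟨?_, ?_⟩, fun z => 1 / V z.1,
    fun z => one_div_pos.2 (hV0 z.1), fun ρ Q₁ Q₂ => ?_⟩
  · nlinarith [hp1 m]
  · nlinarith
  set N := wnorm (fun z : S × U => 1 / V z.1) (Q₁ - Q₂) with hN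
  have hQ : ∀ i u, |Q₁ (i, u) - Q₂ (i, u)| ≤ N * V i := by
    intro i u
    have h : |1 / V i * (Q₁ - Q₂) (i, u)| ≤ N :=
      le_ciSup (f := fun z : S × U => |1 / V z.1 * (Q₁ - Q₂) z|) (Set.finite_range _).bddAbove (i, u)
    rwa [abs_mul, abs_of_pos (one_div_pos.2 (hV0 i)), one_div_mul_eq_div, div_le_iff₀ (hV0 i)] at h
  have hN0 : 0 ≤ N := by
    have h := (abs_nonneg _).trans (hQ i₀ (Classical.arbitrary U))
    exact nonneg_of_mul_nonneg_left h (hV0 i₀)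
  refine ciSup_le fun ⟨i, u⟩ => ?_
  have hd : ∀ j, |minQ Q₁ j - minQ Q₂ j| ≤ N * V j := fun j => abs_minQ_sub_le (hQ j)
  have h1 := killed_mono p i₀ i u (h := minQ Q₁ - minQ Q₂) (g := N • V)
    fun j => (abs_le.1 (hd j)).2
  have h2 := killed_mono p i₀ i u (h := minQ Q₂ - minQ Q₁) (g := N • V)
    fun j => by
      have := (abs_le.1 (hd j)).1
      simp only [Pi.sub_apply, Pi.smul_apply, smul_eq_mul]
      linarith
  rw [killed_sub, killed_smul] at h1 h2
  have h3 := mul_le_mul_of_nonneg_left (hVβ i u) hN0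
  have h4 : |killed p i₀ i u (minQ Q₁) - killed p i₀ i u (minQ Q₂)| ≤ N * (β * V i) :=
    abs_le.2 ⟨by linarith, by linarith⟩
  rw [abs_mul, abs_of_pos (one_div_pos.2 (hV0 i)), one_div_mul_eq_div, div_le_iff₀ (hV0 i),
    Pi.sub_apply, fbar_apply, fbar_apply]
  set q := (π (i, u)).toReal with hq
  have hq0 : 0 ≤ q := ENNReal.toReal_nonneg
  have hq1 : 0 ≤ 1 - q := sub_nonneg.2 (hp1 _)
  have h5 : q * (k (i, u) - Q₁ (i, u) - ρ + killed p i₀ i u (minQ Q₁)) + Q₁ (i, u) -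
      (q * (k (i, u) - Q₂ (i, u) - ρ + killed p i₀ i u (minQ Q₂)) + Q₂ (i, u)) =
      (1 - q) * (Q₁ (i, u) - Q₂ (i, u)) +
        q * (killed p i₀ i u (minQ Q₁) - killed p i₀ i u (minQ Q₂)) := by ring
  rw [h5]
  refine (abs_add_le _ _).trans ?_
  rw [abs_mul, abs_mul, abs_of_nonneg hq0, abs_of_nonneg hq1]
  have h6 := mul_le_mul_of_nonneg_left (hQ i u) hq1
  have h7 := mul_le_mul_of_nonneg_left h4 hq0
  have h8 : (π m).toReal * ((1 - β) * (N * V i)) ≤ q * ((1 - β) * (N * V i)) :=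
    mul_le_mul_of_nonneg_right (hm (i, u))
      (mul_nonneg (by linarith) (mul_nonneg hN0 (hV0 i).le))
  linarith

end

/-! ### Controlled chains: Markov property and bounds on average costs. -/

theorem abs_integral_comp_state_le {S Ω : Type*} [Fintype S] [MeasurableSpace Ω] {P : Measure Ω}
    [IsProbabilityMeasure P] {X : ℕ → Ω → S} (h : S → ℝ) (n : ℕ) :
    |∫ ω, h (X n ω) ∂P| ≤ ∑ j, |h j| := by
  have := norm_integral_le_of_norm_le_const (μ := P) (f := fun ω => h (X n ω)) (C := ∑ j, |h j|)
    (ae_of_all _ fun ω => Finset.single_le_sum (f := fun z => |h z|) (fun _ _ => abs_nonneg _)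
      (Finset.mem_univ _))
  simpa using this

theorem averageCost_le {S U Ω : Type*} [Fintype S] [Fintype U] [MeasurableSpace Ω] {P : Measure Ω}
    [IsProbabilityMeasure P] {X : ℕ → Ω → S} {A : ℕ → Ω → U} (k : S × U → ℝ) (n : ℕ) : averageCost k P X A n ≤ ∑ z, |k z| := by
  have h0 : 0 ≤ ∑ z, |k z| := Finset.sum_nonneg fun _ _ => abs_nonneg _
  have h1 : ∀ m, ∫ ω, k (X m ω, A m ω) ∂P ≤ ∑ z, |k z| := fun m => by
    have := norm_integral_le_of_norm_le_const (μ := P) (f := fun ω => k (X m ω, A m ω))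
      (C := ∑ z, |k z|) (ae_of_all _ fun ω => Finset.single_le_sum (f := fun z => |k z|)
        (fun _ _ => abs_nonneg _) (Finset.mem_univ _))
    exact (le_abs_self _).trans (by simpa using this)
  rw [averageCost, one_div_mul_eq_div]
  refine div_le_of_le_mul₀ n.cast_nonneg h0 ?_
  refine (Finset.sum_le_sum fun m _ => h1 m).trans ?_
  simp [mul_comm]

theorem IsControlledChain.history_le {S U Ω : Type*} [MeasurableSpace S] [MeasurableSpace U]
    [MeasurableSpace Ω] {p : S → U → PMF S} {P : Measure Ω} {X : ℕ → Ω → S} {A : ℕ → Ω → U}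
    (hc : IsControlledChain p P X A) (n : ℕ) :
    history X A n ≤ ‹MeasurableSpace Ω› :=
  Measurable.comap_le <| measurable_pi_lambda _ fun m =>
    (hc.measurable_state m).prodMk (hc.measurable_control m)

section ControlledChain

variable {S U : Type*} [Fintype S] [Fintype U] [MeasurableSpace S] [MeasurableSpace U]
  [MeasurableSingletonClass S] [MeasurableSingletonClass U] {p : S → U → PMF S}
  {Ω : Type*} [MeasurableSpace Ω] {P : Measure Ω} {X : ℕ → Ω → S} {A : ℕ → Ω → U}

theorem measurable_history_pair {S U Ω : Type*} [MeasurableSpace S] [MeasurableSpace U]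
    (X : ℕ → Ω → S) (A : ℕ → Ω → U) {m n : ℕ} (hmn : m ≤ n) :
    Measurable[history X A n] fun ω => (X m ω, A m ω) :=
  (measurable_pi_apply (⟨m, Nat.lt_succ_of_le hmn⟩ : Fin (n + 1))).comp
    (comap_measurable fun ω (m : Fin (n + 1)) => (X m ω, A m ω))

theorem measurable_of_pair {F : S × U → ℝ} {X : Ω → S} {A : Ω → U} (hX : Measurable X)
    (hA : Measurable A) : Measurable fun ω => F (X ω, A ω) :=
  (measurable_of_finite F).comp (hX.prodMk hA)

namespace IsControlledChain

theorem measurable_pair (hc : IsControlledChain p P X A) (F : S × U → ℝ) (n : ℕ) :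
    Measurable fun ω => F (X n ω, A n ω) :=
  measurable_of_pair (hc.measurable_state n) (hc.measurable_control n)

variable [IsProbabilityMeasure P]

theorem integrable_pair (hc : IsControlledChain p P X A) (F : S × U → ℝ) (n : ℕ) :
    Integrable (fun ω => F (X n ω, A n ω)) P := by
  refine Integrable.of_bound (hc.measurable_pair F n).aestronglyMeasurable (∑ z, ‖F z‖)
    (ae_of_all _ fun ω => ?_)
  exact Finset.single_le_sum (f := fun z => ‖F z‖) (fun _ _ => norm_nonneg _) (Finset.mem_univ _)

theorem integrable_comp_state (hc : IsControlledChain p P X A) (g : S → ℝ) (n : ℕ) :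
    Integrable (fun ω => g (X n ω)) P :=
  hc.integrable_pair (fun z => g z.1) n

/-- The Markov property, integrated over an event of the history. -/
theorem setIntegral_succ (hc : IsControlledChain p P X A) (n : ℕ) {s : Set Ω}
    (hs : MeasurableSet[history X A n] s) (g : S → ℝ) :
    ∫ ω in s, g (X (n + 1) ω) ∂P =
      ∫ ω in s, ∑ j, (p (X n ω) (A n ω) j).toReal * g j ∂P := by
  classical
  have hm := hc.history_le n
  have hind : ∀ j, MeasurableSet (X (n + 1) ⁻¹' {j}) := fun j =>
    hc.measurable_state (n + 1) (measurableSet_singleton j)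
  have hint : ∀ j, Integrable (Set.indicator (X (n + 1) ⁻¹' {j}) (fun _ => (1 : ℝ))) P :=
    fun j => (integrable_const 1).indicator (hind j)
  have h1 : ∀ ω, g (X (n + 1) ω) =
      ∑ j, Set.indicator (X (n + 1) ⁻¹' {j}) (fun _ => (1 : ℝ)) ω * g j := by
    intro ω
    simp [Set.indicator_apply]
  have h2 : ∀ j, ∫ ω in s, Set.indicator (X (n + 1) ⁻¹' {j}) (fun _ => (1 : ℝ)) ω ∂P =
      ∫ ω in s, (p (X n ω) (A n ω) j).toReal ∂P := by
    intro j
    rw [← setIntegral_condExp hm (hint j) hs]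
    exact integral_congr_ae (ae_restrict_of_ae (hc.markov n j))
  simp_rw [h1]
  rw [integral_finsetSum _ fun j _ => ((hint j).mul_const _).integrableOn,
    integral_finsetSum _ fun j _ =>
      ((hc.integrable_pair (fun z => (p z.1 z.2 j).toReal) n).mul_const _).integrableOn]
  refine Finset.sum_congr rfl fun j _ => ?_
  rw [integral_mul_const, integral_mul_const, h2]

theorem integral_succ (hc : IsControlledChain p P X A) (n : ℕ) (g : S → ℝ) :
    ∫ ω, g (X (n + 1) ω) ∂P = ∫ ω, ∑ j, (p (X n ω) (A n ω) j).toReal * g j ∂P := by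
  simpa using hc.setIntegral_succ n MeasurableSet.univ g

/-- Poisson's equation along a controlled chain: the expected total cost up to time `n` in terms of
a potential `h`, a constant `c` and the expected defects. -/
theorem sum_integral_cost (hc : IsControlledChain p P X A) (k : S × U → ℝ) (c : ℝ) (h : S → ℝ)
    (n : ℕ) :
    ∑ m ∈ Finset.range n, ∫ ω, k (X m ω, A m ω) ∂P =
      n * c + (∫ ω, h (X 0 ω) ∂P - ∫ ω, h (X n ω) ∂P) + ∑ m ∈ Finset.range n,
        ∫ ω, (k (X m ω, A m ω) - c + (∑ j, (p (X m ω) (A m ω) j).toReal * h j) - h (X m ω)) ∂P := by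
  induction n with
  | zero => simp
  | succ n ih =>
    rw [Finset.sum_range_succ, Finset.sum_range_succ, ih]
    have hk := hc.integrable_pair k n
    have hE := hc.integrable_pair (fun z => ∑ j, (p z.1 z.2 j).toReal * h j) n
    have hh := hc.integrable_comp_state h n
    -- By the Markov property the transition mean of `h` integrates to the mean of `h` at time `n +
    -- 1`, so the potentials telescope.
    have e1 : ∫ ω, (k (X n ω, A n ω) - c + (∑ j, (p (X n ω) (A n ω) j).toReal * h j)
        - h (X n ω)) ∂P = ∫ ω, k (X n ω, A n ω) ∂P - c + ∫ ω, h (X (n + 1) ω) ∂P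
          - ∫ ω, h (X n ω) ∂P := by
      rw [hc.integral_succ n h, integral_sub _ hh, integral_add _ hE,
        integral_sub hk (integrable_const c), integral_const, probReal_univ, one_smul]
      · exact hk.sub (integrable_const c)
      · exact (hk.sub (integrable_const c)).add hE
    rw [e1]
    push_cast
    ring

/-- If the optimality inequality holds, then the potential bounds the average costs below. -/
theorem le_averageCost (hc : IsControlledChain p P X A) {k : S × U → ℝ} {c : ℝ} {h : S → ℝ}
    (hle : ∀ i u, h i ≤ k (i, u) - c + ∑ j, (p i u j).toReal * h j) {n : ℕ} (hn : n ≠ 0) :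
    c - 2 * (∑ j, |h j|) / n ≤ averageCost k P X A n := by
  have hn' : (0 : ℝ) < n := Nat.cast_pos.2 (Nat.pos_of_ne_zero hn)
  have h0 : 0 ≤ ∑ m ∈ Finset.range n, ∫ ω, (k (X m ω, A m ω) - c +
      (∑ j, (p (X m ω) (A m ω) j).toReal * h j) - h (X m ω)) ∂P :=
    Finset.sum_nonneg fun m _ => integral_nonneg fun ω => sub_nonneg.2 (hle _ _)
  have h1 := (abs_le.1 (abs_integral_comp_state_le (P := P) (X := X) h 0)).1
  have h2 := (abs_le.1 (abs_integral_comp_state_le (P := P) (X := X) h n)).2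
  rw [averageCost, hc.sum_integral_cost k c h n, one_div_mul_eq_div, le_div_iff₀ hn', sub_mul,
    div_mul_cancel₀ _ hn'.ne']
  linarith

/-- If Poisson's equation holds along the chain, then the average cost converges. -/
theorem tendsto_averageCost (hc : IsControlledChain p P X A) {k : S × U → ℝ} {c : ℝ} {h : S → ℝ}
    (heq : ∀ n, ∀ᵐ ω ∂P,
      h (X n ω) = k (X n ω, A n ω) - c + ∑ j, (p (X n ω) (A n ω) j).toReal * h j) :
    Tendsto (averageCost k P X A) atTop (𝓝 c) := by
  have h0 : ∀ m, ∫ ω, (k (X m ω, A m ω) - c +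
      (∑ j, (p (X m ω) (A m ω) j).toReal * h j) - h (X m ω)) ∂P = 0 := by
    intro m
    refine integral_eq_zero_of_ae ?_
    filter_upwards [heq m] with ω hω
    simp [hω]
  have hlim : Tendsto (fun n : ℕ => 2 * (∑ j, |h j|) / (n : ℝ)) atTop (𝓝 0) :=
    tendsto_const_div_atTop_nhds_zero_nat _
  rw [tendsto_iff_norm_sub_tendsto_zero]
  refine squeeze_zero' (Eventually.of_forall fun _ => norm_nonneg _) ?_ hlim
  filter_upwards [eventually_ne_atTop 0] with n hn
  have hn' : (0 : ℝ) < n := Nat.cast_pos.2 (Nat.pos_of_ne_zero hn)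
  have h1 := abs_le.1 (abs_integral_comp_state_le (P := P) (X := X) h 0)
  have h2 := abs_le.1 (abs_integral_comp_state_le (P := P) (X := X) h n)
  have e : averageCost k P X A n - c = (∫ ω, h (X 0 ω) ∂P - ∫ ω, h (X n ω) ∂P) / n := by
    rw [averageCost, hc.sum_integral_cost k c h n, Finset.sum_eq_zero fun m _ => h0 m]
    field_simp
    ring
  rw [e, Real.norm_eq_abs, abs_div, abs_of_pos hn']
  refine div_le_div_of_nonneg_right (abs_le.2 ⟨?_, ?_⟩) hn'.le <;> linarith

theorem le_liminf_averageCost (hc : IsControlledChain p P X A) {k : S × U → ℝ} {c : ℝ} {h : S → ℝ}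
    (hle : ∀ i u, h i ≤ k (i, u) - c + ∑ j, (p i u j).toReal * h j) :
    c ≤ liminf (averageCost k P X A) atTop := by
  have hlim : Tendsto (fun n : ℕ => c - 2 * (∑ j, |h j|) / (n : ℝ)) atTop (𝓝 c) := by
    simpa using (tendsto_const_div_atTop_nhds_zero_nat (2 * ∑ j, |h j|)).const_sub c
  rw [← hlim.liminf_eq]
  refine liminf_le_liminf ?_ hlim.isBoundedUnder_ge ?_
  · filter_upwards [eventually_ne_atTop 0] with n hn
    exact hc.le_averageCost hle hn
  -- A real `liminf` is meaningful here because the averages are bounded above.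
  · exact IsBoundedUnder.isCoboundedUnder_ge
      (isBoundedUnder_of ⟨∑ z, |k z|, fun n => averageCost_le k n⟩)

end IsControlledChain

end ControlledChain

/-! ### The path law of a stationary policy. -/

section PolicyLaw

variable {S U : Type*} [MeasurableSpace S] [MeasurableSpace U]

/-- Identifies the history with the filtration used in `Kernel.condExp_traj`. -/
theorem history_path (n : ℕ) :
    history (pathState (S := S) (U := U)) pathControl n = Filtration.piLE (X := fun _ => S × U) n := by
  rw [Filtration.piLE_eq_comap_frestrictLe]
  refine le_antisymm (Measurable.comap_le ?_) (Measurable.comap_le ?_)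
  · refine @measurable_pi_lambda _ _ _ (_) _ _ fun m => ?_
    exact (measurable_pi_apply (⟨m, Finset.mem_Iic.2 (Nat.lt_succ_iff.1 m.2)⟩ :
      Finset.Iic n)).comp (comap_measurable (Preorder.frestrictLe (π := fun _ => S × U) n))
  · refine @measurable_pi_lambda _ _ _ (_) _ _ fun m => ?_
    exact measurable_history_pair pathState pathControl (Finset.mem_Iic.1 m.2)

variable [Finite S] [Finite U] [MeasurableSingletonClass S] [MeasurableSingletonClass U]
  (p : S → U → PMF S) (φ : S → U) (z : S × U)

instance : IsProbabilityMeasure (policyLaw p φ z) := by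
  unfold policyLaw
  infer_instance

theorem policyLaw_zero : ∀ᵐ ω ∂policyLaw p φ z, ω 0 = z := by
  have h := Kernel.traj_map_frestrictLe_apply (X := fun _ => S × U) (κ := policyKernel p φ) 0 0
    (fun _ => z)
  rw [Kernel.partialTraj_self, Kernel.id_apply] at h
  have h1 : ∀ᵐ y ∂(policyLaw p φ z).map (Preorder.frestrictLe (π := fun _ => S × U) 0),
      y ⟨0, by simp⟩ = z := by
    rw [policyLaw, h, ae_dirac_iff]
    exact (Set.toFinite _).measurableSet
  exact ae_of_ae_map (by fun_prop) h1

theorem policyKernel_apply (n : ℕ) (y : (i : Finset.Iic n) → S × U) :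
    policyKernel p φ n y = ((p (y ⟨n, by simp⟩).1 (y ⟨n, by simp⟩).2).map
      fun j => (j, φ j)).toMeasure := rfl

/-- Given the path up to time `n`, the next pair has a law carried by the graph of `φ`. Time `0` is
excluded, as the initial control is arbitrary. -/
theorem policyLaw_succ (n : ℕ) :
    ∀ᵐ ω ∂policyLaw p φ z, (ω (n + 1)).2 = φ (ω (n + 1)).1 := by
  have hB : MeasurableSet {z : S × U | z.2 ≠ φ z.1} := Set.Finite.measurableSet (Set.toFinite _)
  have hE : Measurable fun ω : ℕ → S × U => ω (n + 1) := measurable_pi_apply _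
  have key : ∀ y, Kernel.traj (X := fun _ => S × U) (policyKernel p φ) n y
      ((fun ω => ω (n + 1)) ⁻¹' {z : S × U | z.2 ≠ φ z.1}) = 0 := by
    intro y
    rw [← Measure.map_apply hE hB, ← Kernel.map_apply _ hE, Kernel.map_traj_succ_self,
      policyKernel_apply, PMF.toMeasure_apply_eq_zero_iff _ hB, PMF.support_map,
      Set.disjoint_left]
    rintro _ ⟨j, -, rfl⟩
    simp
  have h : policyLaw p φ z ((fun ω => ω (n + 1)) ⁻¹' {z : S × U | z.2 ≠ φ z.1}) = 0 := by
    rw [policyLaw, ← Kernel.traj_comp_partialTraj (Nat.zero_le n), Kernel.comp_apply' _ _ _ (hE hB)]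
    simp only [key, lintegral_zero]
  exact ae_iff.2 h

/-- The path process of a stationary policy is a controlled chain. -/
theorem isControlledChain_policyLaw :
    IsControlledChain p (policyLaw p φ z) pathState pathControl where
  measurable_state n := measurable_fst.comp (measurable_pi_apply n)
  measurable_control n := measurable_snd.comp (measurable_pi_apply n)
  markov n j := by
    have hE : Measurable fun ω : ℕ → S × U => ω (n + 1) := measurable_pi_apply _
    have hB : MeasurableSet {z : S × U | z.1 = j} := Set.Finite.measurableSet (Set.toFinite _)
    have hs : pathState (n + 1) ⁻¹' {j} = (fun ω : ℕ → S × U => ω (n + 1)) ⁻¹' {z | z.1 = j} := rfl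
    rw [history_path]
    refine (Kernel.condExp_traj (X := fun _ => S × U) (Nat.zero_le n)
      ((integrable_const 1).indicator (hs ▸ hE hB))).trans (ae_of_all _ fun ω => ?_)
    have h1 : (fun i : S => (i, φ i)) ⁻¹' {z : S × U | z.1 = j} = {j} := by
      ext i
      simp
    dsimp only
    rw [integral_indicator_const _ (hs ▸ hE hB), smul_eq_mul, mul_one, hs, Measure.real,
      ← Measure.map_apply hE hB, ← Kernel.map_apply _ hE, Kernel.map_traj_succ_self,
      policyKernel_apply, PMF.toMeasure_map_apply _ _ _ (measurable_of_finite _) hB, h1,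
      PMF.toMeasure_apply_singleton _ _ (measurableSet_singleton j)]
    rfl

end PolicyLaw

/-! ### The return time to `i₀` and relative Q-values. -/

section

/-- The pointwise sum of a series with summable `L¹` norms is integrable. -/
theorem integrable_of_hasSum {Ω : Type*} [MeasurableSpace Ω] {P : Measure Ω} {F : ℕ → Ω → ℝ}
    {G : Ω → ℝ} (hF : ∀ m, Integrable (F m) P) (hsum : Summable fun m => ∫ ω, ‖F m ω‖ ∂P)
    (hG : ∀ᵐ ω ∂P, HasSum (fun m => F m ω) (G ω)) : Integrable G P := by
  have hmeas : AEStronglyMeasurable G P := by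
    refine aestronglyMeasurable_of_tendsto_ae atTop
      (f := fun n ω => ∑ m ∈ Finset.range n, F m ω)
      (fun n => (integrable_finsetSum _ fun m _ => hF m).aestronglyMeasurable) ?_
    filter_upwards [hG] with ω hω
    exact hω.tendsto_sum_nat
  refine ⟨hmeas, ?_⟩
  have h1 : ∫⁻ ω, ‖G ω‖ₑ ∂P ≤ ∫⁻ ω, ∑' m, ‖F m ω‖ₑ ∂P := by
    refine lintegral_mono_ae ?_
    filter_upwards [hG] with ω hω
    rw [← hω.tsum_eq]
    exact enorm_tsum_le_tsum_enorm
  have h2 : ∫⁻ ω, ∑' m, ‖F m ω‖ₑ ∂P = ∑' m, ENNReal.ofReal (∫ ω, ‖F m ω‖ ∂P) := by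
    rw [lintegral_tsum fun m => (hF m).aestronglyMeasurable.enorm]
    exact tsum_congr fun m => (ofReal_integral_norm_eq_lintegral_enorm (hF m)).symm
  exact h1.trans_lt (h2 ▸ hsum.tsum_ofReal_lt_top)

/-- The event that the path is not in `i₀` at the times `1, …, n`. -/
def alive {S : Type*} (U : Type*) (i₀ : S) (n : ℕ) : Set (ℕ → S × U) :=
  {ω | ∀ m, 1 ≤ m → m ≤ n → pathState m ω ≠ i₀}

theorem alive_zero {S : Type*} (U : Type*) (i₀ : S) : alive U i₀ 0 = Set.univ :=
  Set.eq_univ_of_forall fun _ _ h1 h0 => absurd (h1.trans h0) (by simp)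

theorem alive_succ {S : Type*} (U : Type*) (i₀ : S) (n : ℕ) :
    alive U i₀ (n + 1) = alive U i₀ n ∩ {ω | pathState (n + 1) ω ≠ i₀} := by
  ext ω
  refine ⟨fun h => ⟨fun m h1 hm => h m h1 (hm.trans n.le_succ), h _ (by simp) le_rfl⟩, ?_⟩
  rintro ⟨h, h'⟩ m h1 hm
  rcases Nat.le_succ_iff.1 hm with hm | rfl
  · exact h m h1 hm
  · exact h'

/-- On paths that return to `i₀`, being alive at time `n` means that the return is later. -/
theorem mem_alive_iff {S U : Type*} {i₀ : S} {ω : ℕ → S × U}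
    (hω : ∃ m, 1 ≤ m ∧ pathState m ω = i₀) (n : ℕ) : ω ∈ alive U i₀ n ↔ n < returnTime i₀ ω := by
  have hmem : returnTime i₀ ω ∈ {m | 1 ≤ m ∧ pathState m ω = i₀} := Nat.sInf_mem hω
  constructor
  · intro h
    by_contra! hlt
    exact h _ hmem.1 hlt hmem.2
  · intro h m h1 hm heq
    exact Nat.notMem_of_lt_sInf (hm.trans_lt h) ⟨h1, heq⟩

theorem measurableSet_alive_history {S U : Type*} [Finite S] [Finite U] [MeasurableSpace S]
    [MeasurableSpace U] [MeasurableSingletonClass S] [MeasurableSingletonClass U] (i₀ : S) (n : ℕ) :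
    MeasurableSet[history (pathState (S := S) (U := U)) pathControl n] (alive U i₀ n) := by
  have h : alive U i₀ n = ⋂ m, ⋂ (_ : 1 ≤ m), ⋂ (_ : m ≤ n),
      (fun ω => (pathState m ω, pathControl m ω)) ⁻¹' {z : S × U | z.1 ≠ i₀} := by
    ext ω
    simp [alive]
  rw [h]
  refine MeasurableSet.iInter fun m => MeasurableSet.iInter fun _ => MeasurableSet.iInter fun hm => ?_
  exact measurable_history_pair pathState pathControl hm (Set.toFinite _).measurableSet

theorem measurableSet_alive {S U : Type*} [Finite S] [Finite U] [MeasurableSpace S]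
    [MeasurableSpace U] [MeasurableSingletonClass S] [MeasurableSingletonClass U]
    {p : S → U → PMF S} {P : Measure (ℕ → S × U)} (hc : IsControlledChain p P pathState pathControl) (i₀ : S) (n : ℕ) :
    MeasurableSet (alive U i₀ n) :=
  hc.history_le n _ (measurableSet_alive_history i₀ n)

variable {S U : Type*} [Fintype S] [DecidableEq S] [Fintype U] [MeasurableSpace S]
  [MeasurableSpace U] [MeasurableSingletonClass S] [MeasurableSingletonClass U]

variable {p : S → U → PMF S} {P : Measure (ℕ → S × U)} [IsProbabilityMeasure P]

/-- Surviving one more step amounts to setting `g` to `0` at `i₀`; `alive U i₀ n` belongs to the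
history, so the Markov property applies on it. -/
theorem setIntegral_alive_succ (hc : IsControlledChain p P pathState pathControl) (i₀ : S)
    (g : S → ℝ) (n : ℕ) :
    ∫ ω in alive U i₀ (n + 1), g (pathState (n + 1) ω) ∂P =
      ∫ ω in alive U i₀ n, killed p i₀ (pathState n ω) (pathControl n ω) g ∂P := by
  simp_rw [killed_eq_sum_ite]
  rw [← hc.setIntegral_succ n (measurableSet_alive_history i₀ n) fun j => if j ≠ i₀ then g j else 0,
    ← integral_indicator (measurableSet_alive hc i₀ n),
    ← integral_indicator (measurableSet_alive hc i₀ (n + 1))]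
  congr 1
  funext ω
  classical
  simp only [alive_succ, Set.indicator_apply, Set.mem_inter_iff, Set.mem_ofPred_eq]
  by_cases h1 : ω ∈ alive U i₀ n <;> simp [h1]

/-- The time of the first visit to `i₀` has a geometric tail. -/
theorem exists_measureReal_alive_le [Nonempty U]
    (hc : IsControlledChain p P pathState pathControl) (hirr : IrreducibleUnderAllControls p)
    (i₀ : S) : ∃ C : ℝ, ∃ β ∈ Set.Ioo (0 : ℝ) 1, ∀ n, P.real (alive U i₀ n) ≤ C * β ^ n := by
  obtain ⟨V, hV, β, hβ, hVβ⟩ := exists_lyapunov hirr i₀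
  have hint : ∀ n, Integrable (fun ω => V (pathState n ω)) P := hc.integrable_comp_state V
  have hdec : ∀ n, ∫ ω in alive U i₀ n, V (pathState n ω) ∂P ≤
      (∫ ω, V (pathState 0 ω) ∂P) * β ^ n := by
    intro n
    induction n with
    | zero => simp [alive_zero]
    | succ n ih =>
      rw [setIntegral_alive_succ hc i₀ V n]
      have h1 : ∫ ω in alive U i₀ n, killed p i₀ (pathState n ω) (pathControl n ω) V ∂P ≤
          ∫ ω in alive U i₀ n, β * V (pathState n ω) ∂P :=
        setIntegral_mono (hc.integrable_pair (fun z => killed p i₀ z.1 z.2 V) n).integrableOn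
          ((hint n).const_mul β).integrableOn fun ω => hVβ _ _
      rw [integral_const_mul] at h1
      have h2 := mul_le_mul_of_nonneg_left ih hβ.1.le
      rw [pow_succ]
      linarith
  refine ⟨_, β, hβ, fun n => le_trans ?_ (hdec n)⟩
  have h1 : ∫ _ω in alive U i₀ n, (1 : ℝ) ∂P ≤ ∫ ω in alive U i₀ n, V (pathState n ω) ∂P :=
    setIntegral_mono (integrable_const 1) (hint n).integrableOn fun ω => hV _
  simpa using h1

/-- Expected cost up to the time `n` or the first visit to `i₀`, in terms of a solution `Q` of the
policy evaluation equation for the chain killed on entering `i₀`. -/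
theorem sum_setIntegral_alive (hc : IsControlledChain p P pathState pathControl) {i₀ : S}
    {φ : S → U} (hφ : ∀ n, ∀ᵐ ω ∂P, pathControl (n + 1) ω = φ (pathState (n + 1) ω))
    {k Q : S × U → ℝ} {c : ℝ}
    (hQ : ∀ i u, Q (i, u) = k (i, u) - c + killed p i₀ i u fun j => Q (j, φ j)) (n : ℕ) :
    ∑ m ∈ Finset.range n, ∫ ω in alive U i₀ m, (k (ω m) - c) ∂P =
      ∫ ω, Q (ω 0) ∂P - ∫ ω in alive U i₀ n, Q (ω n) ∂P := by
  induction n with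
  | zero => simp [alive_zero]
  | succ n ih =>
    have hQn : Integrable (fun ω : ℕ → S × U => Q (ω n)) P := hc.integrable_pair Q n
    have hKn : Integrable (fun ω : ℕ → S × U =>
        killed p i₀ (pathState n ω) (pathControl n ω) fun j => Q (j, φ j)) P :=
      hc.integrable_pair (fun z => killed p i₀ z.1 z.2 fun j => Q (j, φ j)) n
    have h1 : ∫ ω in alive U i₀ (n + 1), Q (ω (n + 1)) ∂P =
        ∫ ω in alive U i₀ (n + 1), Q (pathState (n + 1) ω, φ (pathState (n + 1) ω)) ∂P := by
      refine integral_congr_ae (ae_restrict_of_ae ?_)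
      filter_upwards [hφ n] with ω hω
      rw [← hω]
      rfl
    have h2 : ∀ ω : ℕ → S × U, k (ω n) - c = Q (ω n) -
        killed p i₀ (pathState n ω) (pathControl n ω) fun j => Q (j, φ j) := by
      intro ω
      have := hQ (ω n).1 (ω n).2
      rw [Prod.mk.eta] at this
      rw [this]
      exact (add_sub_cancel_right _ _).symm
    rw [Finset.sum_range_succ, ih, h1,
      setIntegral_alive_succ hc i₀ (fun j => Q (j, φ j)) n]
    simp_rw [h2]
    rw [integral_sub hQn.integrableOn hKn.integrableOn]
    ring

/-- A solution of the policy evaluation equation for the chain killed on entering `i₀` is the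
expected cost until the return to `i₀`. -/
theorem isRelativeQValue_of_eq [Nonempty U] (hirr : IrreducibleUnderAllControls p) {i₀ : S}
    {φ : S → U} {k Q : S × U → ℝ} {c : ℝ}
    (hQ : ∀ i u, Q (i, u) = k (i, u) - c + killed p i₀ i u fun j => Q (j, φ j)) (z : S × U) :
    IsRelativeQValue p k i₀ φ c z (Q z) := by
  set P := policyLaw p φ z with hP
  have hc : IsControlledChain p P pathState pathControl := isControlledChain_policyLaw p φ z
  obtain ⟨C, β, hβ, htail⟩ := exists_measureReal_alive_le hc hirr i₀
  have hgeom : Tendsto (fun n : ℕ => C * β ^ n) atTop (𝓝 0) := by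
    simpa using (tendsto_pow_atTop_nhds_zero_of_lt_one hβ.1.le hβ.2).const_mul C
  have hreturn : ∀ᵐ ω ∂P, ∃ m, 1 ≤ m ∧ pathState m ω = i₀ := by
    have hle : ∀ n, P.real {ω | ¬ ∃ m, 1 ≤ m ∧ pathState m ω = i₀} ≤ C * β ^ n := fun n => by
      refine (measureReal_mono (s₂ := alive U i₀ n) ?_).trans (htail n)
      intro ω hω m h1 _ heq
      exact hω ⟨m, h1, heq⟩
    have h0 := ge_of_tendsto' hgeom hle
    exact ae_iff.2 ((measureReal_eq_zero_iff).1 (le_antisymm h0 measureReal_nonneg))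
  -- The sum up to the random time becomes a series of costs on the survival events, whose `L¹`
  -- norms decay geometrically.
  let F : ℕ → (ℕ → S × U) → ℝ := fun m => (alive U i₀ m).indicator fun ω => k (ω m) - c
  have hcost : ∀ m, Integrable (fun ω : ℕ → S × U => k (ω m) - c) P := fun m =>
    hc.integrable_pair (fun z => k z - c) m
  have hF : ∀ m, Integrable (F m) P := fun m =>
    (hcost m).indicator (measurableSet_alive hc i₀ m)
  have hbound : ∀ (q : S × U → ℝ) m, ‖∫ ω in alive U i₀ m, q (ω m) ∂P‖ ≤
      (∑ z, ‖q z‖) * (C * β ^ m) := by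
    intro q m
    refine (norm_setIntegral_le_of_norm_le_const (measure_lt_top _ _) fun ω _ =>
      Finset.single_le_sum (f := fun z => ‖q z‖) (fun _ _ => norm_nonneg _)
        (Finset.mem_univ _)).trans ?_
    exact mul_le_mul_of_nonneg_left (htail m) (Finset.sum_nonneg fun _ _ => norm_nonneg _)
  have hsum : Summable fun m => ∫ ω, ‖F m ω‖ ∂P := by
    refine Summable.of_nonneg_of_le (fun m => integral_nonneg fun _ => norm_nonneg _) (fun m => ?_)
      (((summable_geometric_of_lt_one hβ.1.le hβ.2).mul_left C).mul_left (∑ z, ‖|k z - c|‖))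
    have h1 : ∫ ω, ‖F m ω‖ ∂P = ∫ ω in alive U i₀ m, |k (ω m) - c| ∂P := by
      rw [← integral_indicator (measurableSet_alive hc i₀ m)]
      simp only [F, norm_indicator_eq_indicator_norm, Real.norm_eq_abs]
    rw [h1]
    exact (le_abs_self _).trans (hbound (fun z => |k z - c|) m)
  have hG : ∀ᵐ ω ∂P, HasSum (fun m => F m ω)
      (∑ m ∈ Finset.range (returnTime i₀ ω), (k (ω m) - c)) := by
    filter_upwards [hreturn] with ω hω
    have h1 : ∀ m, F m ω = if m < returnTime i₀ ω then k (ω m) - c else 0 := by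
      intro m
      classical
      simp only [F, Set.indicator_apply, mem_alive_iff hω]
    have h2 : ∑ m ∈ Finset.range (returnTime i₀ ω), (k (ω m) - c) =
        ∑ m ∈ Finset.range (returnTime i₀ ω), F m ω :=
      Finset.sum_congr rfl fun m hm => by rw [h1, if_pos (Finset.mem_range.1 hm)]
    rw [h2]
    exact hasSum_sum_of_ne_finset_zero fun m hm => by
      rw [h1, if_neg fun h => hm (Finset.mem_range.2 h)]
  refine ⟨hreturn, integrable_of_hasSum hF hsum hG, ?_⟩
  have h1 := (hasSum_integral_of_summable_integral_norm hF hsum).tendsto_sum_nat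
  have h2 : ∫ ω, ∑' m, F m ω ∂P =
      ∫ ω, ∑ m ∈ Finset.range (returnTime i₀ ω), (k (ω m) - c) ∂P :=
    integral_congr_ae (hG.mono fun ω hω => hω.tsum_eq)
  have h3 : ∫ ω, Q (ω 0) ∂P = Q z := by
    have : ∫ ω, Q (ω 0) ∂P = ∫ _ω : ℕ → S × U, Q z ∂P :=
      integral_congr_ae ((policyLaw_zero p φ z).mono fun ω hω => congrArg Q hω)
    rw [this, integral_const, probReal_univ, one_smul]
  have h4 : Tendsto (fun n => ∫ ω in alive U i₀ n, Q (ω n) ∂P) atTop (𝓝 0) :=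
    squeeze_zero_norm (hbound Q) (by simpa using hgeom.const_mul (∑ z, ‖Q z‖))
  have h5 : ∀ n, ∑ m ∈ Finset.range n, ∫ ω, F m ω ∂P =
      Q z - ∫ ω in alive U i₀ n, Q (ω n) ∂P := by
    intro n
    rw [← h3, ← sum_setIntegral_alive hc (fun n => policyLaw_succ p φ z n) hQ n]
    exact Finset.sum_congr rfl fun m _ => integral_indicator (measurableSet_alive hc i₀ m)
  rw [h2] at h1
  simp_rw [h5] at h1
  exact tendsto_nhds_unique h1 (by simpa using h4.const_sub (Q z))

end

/-! ### The optimal value of the killed chain as a function of `ρ`. -/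

section Value

variable {S U : Type*} [Fintype S] [DecidableEq S] {p : S → U → PMF S}

/-- Value of a policy for the running cost `k - ρ` and the chain killed on entering `i₀`, as an
affine function of `ρ`. -/
theorem exists_policy_value_affine (hirr : IrreducibleUnderAllControls p) (k : S × U → ℝ) (i₀ : S)
    (φ : S → U) : ∃ a b : S → ℝ, (∀ i, 1 ≤ b i) ∧ ∀ (ρ : ℝ) i,
      a i - ρ * b i = k (i, φ i) - ρ + killed p i₀ i (φ i) fun j => a j - ρ * b j := by
  obtain ⟨a, ha⟩ := exists_policy_value hirr i₀ φ fun i => k (i, φ i)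
  -- Unit running cost: `b` is the mean time to the first entry into `i₀` after time `0`.
  obtain ⟨b, hb⟩ := exists_policy_value hirr i₀ φ fun _ => 1
  have hneg : ∀ i, killed p i₀ i (φ i) (-b) = - killed p i₀ i (φ i) b := fun i => by simp [killed]
  have h1 := nonpos_of_le_killed hirr i₀ φ (d := -b) fun i => by
    rw [hneg, Pi.neg_apply]
    linarith [hb i]
  refine ⟨a, b, fun i => ?_, fun ρ i => ?_⟩
  · linarith [hb i, hneg i, killed_nonpos p i₀ i (φ i) h1]
  · have h2 : (fun j => a j - ρ * b j) = a - ρ • b := rfl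
    rw [h2, killed_sub, killed_smul]
    linear_combination ha i - ρ * hb i

/-- The optimal value for the running cost `k - ρ` and the chain killed on entering `i₀`: it solves
the optimality equation, and its value in `i₀` is a lower envelope of finitely many affine
functions of `ρ`. -/
theorem exists_value [Finite U] [Nonempty U] (hirr : IrreducibleUnderAllControls p)
    (k : S × U → ℝ) (i₀ : S) : ∃ h : ℝ → S → ℝ,
      (∀ ρ i, ∃ u, h ρ i = k (i, u) - ρ + killed p i₀ i u (h ρ)) ∧
      (∀ ρ i u, h ρ i ≤ k (i, u) - ρ + killed p i₀ i u (h ρ)) ∧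
      ∃ α γ : (S → U) → ℝ, (∀ φ, 1 ≤ γ φ) ∧ (∀ ρ φ, h ρ i₀ ≤ α φ - ρ * γ φ) ∧
        ∀ ρ, ∃ φ, h ρ i₀ = α φ - ρ * γ φ := by
  choose a b hb hab using exists_policy_value_affine hirr k i₀
  choose h ψ hψ hle using fun ρ => exists_optimal_value hirr i₀ fun i u => k (i, u) - ρ
  refine ⟨h, fun ρ i => ⟨_, hψ ρ i⟩, hle, fun φ => a φ i₀, fun φ => b φ i₀, fun φ => hb φ i₀,
    fun ρ φ => ?_, fun ρ => ⟨ψ ρ, ?_⟩⟩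
  -- The optimal value lies below that of every policy, and equals that of its minimiser `ψ ρ`.
  · have := nonpos_of_le_killed hirr i₀ φ (d := h ρ - fun j => a φ j - ρ * b φ j) (fun i => by
      rw [killed_sub, Pi.sub_apply]
      linarith [hle ρ i (φ i), hab φ ρ i]) i₀
    rw [Pi.sub_apply] at this
    linarith
  · have h1 := nonpos_of_le_killed hirr i₀ (ψ ρ) (d := h ρ - fun j => a (ψ ρ) j - ρ * b (ψ ρ) j)
      (fun i => by
        rw [killed_sub, Pi.sub_apply]
        linarith [hψ ρ i, hab (ψ ρ) ρ i]) i₀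
    have h2 := nonpos_of_le_killed hirr i₀ (ψ ρ) (d := (fun j => a (ψ ρ) j - ρ * b (ψ ρ) j) - h ρ)
      (fun i => by
        rw [killed_sub, Pi.sub_apply]
        linarith [hψ ρ i, hab (ψ ρ) ρ i]) i₀
    rw [Pi.sub_apply] at h1 h2
    linarith

/-- Poisson's equation for a stationary policy. -/
theorem exists_poisson (hirr : IrreducibleUnderAllControls p) (k : S × U → ℝ) (i₀ : S)
    (φ : S → U) : ∃ (c : ℝ) (g : S → ℝ), g i₀ = 0 ∧
      ∀ i, g i = k (i, φ i) - c + ∑ j, (p i (φ i) j).toReal * g j := by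
  obtain ⟨a, b, hb, hab⟩ := exists_policy_value_affine hirr k i₀ φ
  have h0 : a i₀ - a i₀ / b i₀ * b i₀ = 0 := by
    rw [div_mul_cancel₀ _ (zero_lt_one.trans_le (hb i₀)).ne', sub_self]
  -- Cost per cycle over cycle length is the constant that makes the potential vanish at `i₀`.
  refine ⟨a i₀ / b i₀, fun j => a j - a i₀ / b i₀ * b j, h0, fun i => ?_⟩
  rw [← killed_eq_sum p i₀ i (φ i) h0]
  exact hab _ i

/-- Solutions of the optimality equation for the chain killed on entering `i₀` are unique. -/
theorem le_of_optimality_equation [Finite U] (hirr : IrreducibleUnderAllControls p) {i₀ : S}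
    {r : S → U → ℝ} {h g : S → ℝ} (hh : ∀ i u, h i ≤ r i u + killed p i₀ i u h)
    (hg : ∀ i, ∃ u, g i = r i u + killed p i₀ i u g) (i : S) : h i ≤ g i := by
  choose φ hφ using hg
  have := nonpos_of_le_killed hirr i₀ φ (d := h - g) (fun i => by
    rw [killed_sub, Pi.sub_apply]
    linarith [hh i (φ i), hφ i]) i
  rw [Pi.sub_apply] at this
  linarith

end Value

/-! ### Verification for the average cost and optimal policies. -/

section Average

variable {S U : Type*} [Fintype S] [Fintype U] [MeasurableSpace S]
  [MeasurableSpace U] [MeasurableSingletonClass S] [MeasurableSingletonClass U]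
  {p : S → U → PMF S}

/-- The average cost of a stationary policy is the constant in Poisson's equation. -/
theorem tendsto_averageCost_policyLaw {k : S × U → ℝ} {φ : S → U} {c : ℝ} {g : S → ℝ}
    (hg : ∀ i, g i = k (i, φ i) - c + ∑ j, (p i (φ i) j).toReal * g j) (i : S) :
    Tendsto (averageCost k (policyLaw p φ (i, φ i)) pathState pathControl) atTop (𝓝 c) := by
  refine (isControlledChain_policyLaw p φ (i, φ i)).tendsto_averageCost (h := g) fun n => ?_
  have hφ : ∀ᵐ ω ∂policyLaw p φ (i, φ i), pathControl n ω = φ (pathState n ω) := by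
    cases n with
    | zero =>
      filter_upwards [policyLaw_zero p φ (i, φ i)] with ω hω
      simp [pathControl, pathState, hω]
    | succ n => exact policyLaw_succ p φ _ n
  filter_upwards [hφ] with ω hω
  rw [hω]
  exact hg _

theorem mem_averageCosts_of_poisson {k : S × U → ℝ} {φ : S → U} {c : ℝ} {g : S → ℝ}
    (hg : ∀ i, g i = k (i, φ i) - c + ∑ j, (p i (φ i) j).toReal * g j) (i : S) :
    c ∈ averageCosts p k i :=
  ⟨policyLaw p φ (i, φ i), inferInstance, isControlledChain_policyLaw p φ _,
    (policyLaw_zero p φ (i, φ i)).mono fun ω hω => by simp [pathState, hω],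
    tendsto_averageCost_policyLaw hg i⟩

/-- Verification theorem for the average cost optimality equation. -/
theorem isLeast_averageCosts {k : S × U → ℝ} {c : ℝ} {h : S → ℝ}
    (hle : ∀ i u, h i ≤ k (i, u) - c + ∑ j, (p i u j).toReal * h j)
    (heq : ∀ i, ∃ u, h i = k (i, u) - c + ∑ j, (p i u j).toReal * h j) (i : S) :
    IsLeast (averageCosts p k i) c := by
  choose φ hφ using heq
  refine ⟨mem_averageCosts_of_poisson hφ i, ?_⟩
  rintro x ⟨P, hP, hc, -, hx⟩
  exact (hc.le_liminf_averageCost hle).trans_eq hx.liminf_eq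

/-- The optimal stationary policies are the ones that are greedy for the average cost optimality
equation. -/
theorem isOptimalPolicy_iff [DecidableEq S] (hirr : IrreducibleUnderAllControls p)
    {k : S × U → ℝ} {c : ℝ} {h : S → ℝ}
    (hle : ∀ i u, h i ≤ k (i, u) - c + ∑ j, (p i u j).toReal * h j)
    (heq : ∀ i, ∃ u, h i = k (i, u) - c + ∑ j, (p i u j).toReal * h j) {i₀ : S} (h0 : h i₀ = 0)
    (φ : S → U) : IsOptimalPolicy p k φ ↔
      ∀ i, h i = k (i, φ i) - c + ∑ j, (p i (φ i) j).toReal * h j := by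
  have hleast := isLeast_averageCosts hle heq
  refine ⟨fun hopt => ?_, fun hφ i => ⟨c, tendsto_averageCost_policyLaw hφ i, hleast i⟩⟩
  obtain ⟨c', g, hg0, hg⟩ := exists_poisson hirr k i₀ φ
  have hc : c' = c := by
    obtain ⟨x, hx, hx'⟩ := hopt i₀
    rw [tendsto_nhds_unique (tendsto_averageCost_policyLaw hg i₀) hx]
    exact hx'.unique (hleast i₀)
  subst hc
  -- Optimality inequality minus Poisson's equation: `h - g` is subharmonic for `φ`, hence constant,
  -- and it vanishes at `i₀`.
  have hd := eq_of_le_sum hirr φ (d := h - g) fun i => by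
    simp only [Pi.sub_apply, mul_sub, Finset.sum_sub_distrib]
    linarith [hle i (φ i), hg i]
  have hgh : h = g := by
    ext i
    have := hd i i₀
    simp only [Pi.sub_apply, h0, hg0] at this
    linarith
  rw [hgh]
  exact hg

end Average

end SSPQ

/-! ### Assembly of the main theorem. -/

open SSPQ

theorem mainTheorem4 {S U : Type*} [Fintype S] [Fintype U] [DecidableEq S] [DecidableEq U]
    [Nonempty U] [MeasurableSpace S] [MeasurableSpace U]
    [MeasurableSingletonClass S] [MeasurableSingletonClass U]
    -- transition function, running cost, reference state, sampling policy
    (p : S → U → PMF S) (k : S × U → ℝ) (i₀ : S) (Φ : S → PMF U)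
    (hirr : SSPQ.IrreducibleUnderAllControls p)
    (hΦ : ∀ i u, 0 < Φ i u)
    -- the stationary distribution of `Z_n = (X_n, U_n)` under `Φ`
    (π : PMF (S × U)) (hπ : SSPQ.IsStationary p Φ π) :
    -- (a) contractivity of `fbar` in `Q`
    (∃ lam ∈ Set.Ioo (0 : ℝ) 1, ∃ w : S × U → ℝ, (∀ z, 0 < w z) ∧
      ∀ (ρ : ℝ) (Q₁ Q₂ : S × U → ℝ),
        SSPQ.wnorm w (SSPQ.fbar p k i₀ π Q₁ ρ - SSPQ.fbar p k i₀ π Q₂ ρ)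
          ≤ lam * SSPQ.wnorm w (Q₁ - Q₂)) ∧
    -- `Qs ρ` is the unique fixed point of `fbar(·, ρ)`
    ∃ Qs : ℝ → S × U → ℝ,
      (∀ (ρ : ℝ) (Q : S × U → ℝ), SSPQ.fbar p k i₀ π Q ρ = Q ↔ Q = Qs ρ) ∧
      -- (b) shape of `ρ ↦ min_v Qs(ρ)(i₀,v)` and contractivity of `ρ ↦ gbar(Qs(ρ), ρ)`
      ConcaveOn ℝ Set.univ (fun ρ => SSPQ.minQ (Qs ρ) i₀) ∧
      SSPQ.IsPiecewiseLinear (fun ρ => SSPQ.minQ (Qs ρ) i₀) ∧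
      StrictAnti (fun ρ => SSPQ.minQ (Qs ρ) i₀) ∧
      (∃ βmax > (0 : ℝ), ∀ β' : ℝ, 0 < β' → β' < βmax → ∃ μ ∈ Set.Ioo (0 : ℝ) 1, ∀ ρ₁ ρ₂ : ℝ,
        |SSPQ.gbar i₀ β' (Qs ρ₂) ρ₂ - SSPQ.gbar i₀ β' (Qs ρ₁) ρ₁| ≤ μ * |ρ₂ - ρ₁|) ∧
      -- (c) `ρs` is the unique fixed point of `ρ ↦ gbar(Qs(ρ), ρ)`, for every `β' > 0`
      ∃ ρs : ℝ,
        (∀ β' : ℝ, 0 < β' → ∀ ρ : ℝ, SSPQ.gbar i₀ β' (Qs ρ) ρ = ρ ↔ ρ = ρs) ∧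
        -- `ρs` is the minimal average cost, from every initial state
        (∀ i, IsLeast (SSPQ.averageCosts p k i) ρs) ∧
        (∀ (Ω : Type*) [MeasurableSpace Ω] (P : MeasureTheory.Measure Ω)
          [MeasureTheory.IsProbabilityMeasure P] (X : ℕ → Ω → S) (A : ℕ → Ω → U),
          SSPQ.IsControlledChain p P X A →
            ρs ≤ Filter.liminf (SSPQ.averageCost k P X A) Filter.atTop) ∧
        -- `Qs ρs` solves the average-cost optimality equation for Q-values
        SSPQ.minQ (Qs ρs) i₀ = 0 ∧
        (∀ i u, Qs ρs (i, u) = k (i, u) - ρs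
          + ∑ j, (p i u j).toReal * SSPQ.minQ (Qs ρs) j) ∧
        -- the optimal policies are the ones that are greedy for `Qs ρs`, they exist,
        -- and `Qs ρs` is the vector of Q-values of every optimal policy
        (∀ φ : S → U, SSPQ.IsOptimalPolicy p k φ ↔
          ∀ i, Qs ρs (i, φ i) = SSPQ.minQ (Qs ρs) i) ∧
        (∃ φ : S → U, SSPQ.IsOptimalPolicy p k φ) ∧
        (∀ φ : S → U, SSPQ.IsOptimalPolicy p k φ →
          ∀ z, SSPQ.IsRelativeQValue p k i₀ φ ρs z (Qs ρs z)) := by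
  have hπ0 := hπ.ne_zero hirr hΦ
  refine ⟨exists_fbar_contraction hirr k i₀ hπ0, ?_⟩
  obtain ⟨h, hatt, hle, α, γ, hγ, henv, henv'⟩ := exists_value hirr k i₀
  -- One optimality step applied to `h ρ`; minimising over controls gives `h ρ` back.
  let Qs : ℝ → S × U → ℝ := fun ρ z => k z - ρ + killed p i₀ z.1 z.2 (h ρ)
  have hmin : ∀ ρ, minQ (Qs ρ) = h ρ := by
    intro ρ
    ext i
    obtain ⟨u, hu⟩ := hatt ρ i
    exact le_antisymm ((minQ_le _ i u).trans_eq hu.symm) (le_minQ fun u => hle ρ i u)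
  have hfix : ∀ (ρ : ℝ) (Q : S × U → ℝ), fbar p k i₀ π Q ρ = Q ↔ Q = Qs ρ := by
    intro ρ Q
    rw [fbar_eq_self_iff hπ0]
    constructor
    · intro hQ
      have h1 : minQ Q = h ρ := by
        ext i
        refine le_antisymm (le_of_optimality_equation hirr (r := fun i u => k (i, u) - ρ)
          (fun i u => hQ i u ▸ minQ_le Q i u) (hatt ρ) i)
          (le_of_optimality_equation hirr (r := fun i u => k (i, u) - ρ) (hle ρ) (fun i => ?_) i)
        obtain ⟨u, hu⟩ := exists_eq_minQ Q i
        exact ⟨u, hu ▸ hQ i u⟩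
      ext ⟨i, u⟩
      rw [hQ i u, h1]
    · rintro rfl i u
      rw [hmin]
  obtain ⟨ρs, hρs⟩ := exists_zero_of_lower_envelope henv henv' hγ
  have hanti : StrictAnti fun ρ => h ρ i₀ := strictAnti_of_lower_envelope henv henv' hγ
  have hQs : ∀ i u, Qs ρs (i, u) = k (i, u) - ρs + ∑ j, (p i u j).toReal * h ρs j := fun i u => by
    rw [← killed_eq_sum p i₀ i u hρs]
  have hle' : ∀ i u, h ρs i ≤ k (i, u) - ρs + ∑ j, (p i u j).toReal * h ρs j := fun i u => by
    rw [← killed_eq_sum p i₀ i u hρs]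
    exact hle ρs i u
  have hatt' : ∀ i, ∃ u, h ρs i = k (i, u) - ρs + ∑ j, (p i u j).toReal * h ρs j := fun i => by
    obtain ⟨u, hu⟩ := hatt ρs i
    exact ⟨u, by rwa [← killed_eq_sum p i₀ i u hρs]⟩
  have hopt : ∀ φ : S → U, IsOptimalPolicy p k φ ↔ ∀ i, Qs ρs (i, φ i) = h ρs i := fun φ => by
    rw [isOptimalPolicy_iff hirr hle' hatt' hρs φ]
    exact forall_congr' fun i => by rw [hQs, eq_comm]
  refine ⟨Qs, hfix, ?_⟩
  simp only [gbar, hmin]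
  refine ⟨concaveOn_of_lower_envelope henv henv', isPiecewiseLinear_of_lower_envelope henv henv',
    hanti, exists_contraction_of_lower_envelope henv henv' hγ, ρs, fun β' hβ' ρ => ?_,
    isLeast_averageCosts hle' hatt', fun Ω _ P _ X A hc => hc.le_liminf_averageCost hle', hρs, hQs,
    hopt, ?_, fun φ hφ z => isRelativeQValue_of_eq hirr (fun i u => ?_) z⟩
  -- The fixed points are the zeros of `h · i₀`, whatever `β'` is.
  · rw [add_eq_right, mul_eq_zero, or_iff_right hβ'.ne', ← hρs]
    exact hanti.injective.eq_iff
  · choose φ hφ using hatt'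
    exact ⟨φ, (hopt φ).2 fun i => by rw [hQs, ← hφ]⟩
  -- An optimal `φ` is greedy, so the optimality equation is also its policy evaluation equation.
  · have h1 : (fun j => Qs ρs (j, φ j)) = h ρs := funext ((hopt φ).1 hφ)
    rw [h1]
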